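/- Let $\mathsf{w}=\mathsf{w}_1\cdots\mathsf{w}_\ell$ be a reduced expression in the adjacent transpositions $s_1,\dots,s_{n-1}$ of $S_n$, with $\mathsf{w}_j=s_{d_j}$, and let $\sigma=(\sigma_1,\dots,\sigma_\ell)\in\{0,1\}^\ell$ be a mask. Write $\mathsf{w}^{\sigma[j]}=\mathsf{w}_1^{\sigma_1}\cdots\mathsf{w}_j^{\sigma_j}$ and $\mathsf{w}^\sigma=\mathsf{w}^{\sigma[\ell]}$. A position $j$ is a defect if $\mathsf{w}^{\sigma[j-1]}\mathsf{w}_j<\mathsf{w}^{\sigma[j-1]}$ in Bruhat order; $d(\sigma)$ is the number of defects. Let $e(\sigma)$ be the string of signs whose $j$-th entry is $+$ if $j$ is a defect with $\sigma_j=0$ or a non-defect with $\sigma_j=1$, and $-$ otherwise. Let $e_1,\dots,e_n$ be the standard basis of $\mathbb{C}^n$ and $E_i=\mathrm{Span}(e_1,\dots,e_i)$. Let $\mathrm{lpred}(j)$ (resp. $\mathrm{rpred}(j)$) be the greatest $k<j$ with $d_k=d_j-1$ (resp. $d_k=d_j+1$), if there is one. The Bott--Samelson variety $Z_{\mathsf{w}}$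 is the set of $[V_1,\dots,V_\ell]\in \mathrm{Gr}(d_1,n)\times\cdots\times\mathrm{Gr}(d_\ell,n)$ with $V_{\mathrm{lpred}(j)}\subseteq V_j\subseteq V_{\mathrm{rpred}(j)}$ for all $j$, where $V_{\mathrm{lpred}(j)}$ is replaced by $E_{d_j-1}$ if $\mathrm{lpred}(j)$ is undefined and $V_{\mathrm{rpred}(j)}$ by $E_{d_j+1}$ if $\mathrm{rpred}(j)$ is undefined. Let $\mathbb{C}^*$ act on $\mathbb{C}^n$ by $t\cdot e_i=t^{n-i}e_i$, and hence on $Z_{\mathsf{w}}$. Let $p_\sigma=[V_1,\dots,V_\ell]$ with $V_j=\mathrm{Span}(e_{\mathsf{w}^{\sigma[j]}(1)},\dots,e_{\mathsf{w}^{\sigma[j]}(d_j)})$, and let $C_\sigma=\{p\in Z_{\mathsf{w}}\mid \lim_{t\to0}t\cdot p=p_\sigma\}$ be the corresponding Bia\l{}ynicki-Birula cell. Then the number of $+$'s in $e(\sigma)$ equals $\ell(\mathsf{w}^\sigma)+d(\sigma)$, where $\ell(u)$ is the Coxeter length of $u\in S_n$. This number is also the (complex) dimension of $C_\sigma$. Consequently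 $d(\sigma)=\dim C_\sigma-\ell(\mathsf{w}^\sigma)$. -/

import Mathlib

noncomputable section

namespace BottSamelson

/-! ### Words, length, Bruhat order, masks and defects in the symmetric group

Indices are zero-based: `Fin n` stands for `{1, …, n}` and `i : Fin (n - 1)` stands for the
generator `s_{i+1}` of `S_n`. -/

/-- The adjacent transposition of `S_n` exchanging the (zero-based) letters `i` and `i + 1`. -/
def simple {n : ℕ} (i : Fin (n - 1)) : Equiv.Perm (Fin n) :=
  Equiv.swap ⟨i, by omega⟩ ⟨i + 1, by omega⟩

/-- The permutation represented by an expression (product of maps, `(u * v) x = u (v x)`). -/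
def wordProd {n : ℕ} (a : List (Fin (n - 1))) : Equiv.Perm (Fin n) :=
  (a.map simple).prod

/-- `ℓ(u)`: the minimum length of an expression for `u`. -/
def length {n : ℕ} (u : Equiv.Perm (Fin n)) : ℕ :=
  sInf {k | ∃ a : List (Fin (n - 1)), wordProd a = u ∧ a.length = k}

/-- A reduced expression is an expression of minimum length. -/
def IsReduced {n : ℕ} (a : List (Fin (n - 1))) : Prop :=
  a.length = length (wordProd a)

/-- Bruhat order: a reduced expression for `x` is a (not necessarily consecutive) subword of some
reduced expression for `w`. -/
def BruhatLE {n : ℕ} (x w : Equiv.Perm (Fin n)) : Prop :=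
  ∃ a b : List (Fin (n - 1)), IsReduced a ∧ IsReduced b ∧ wordProd a = x ∧ wordProd b = w ∧
    a.Sublist b

/-- Strict Bruhat order. -/
def BruhatLT {n : ℕ} (x w : Equiv.Perm (Fin n)) : Prop :=
  BruhatLE x w ∧ x ≠ w

/-- A mask on an expression of length `l`: `true` is `1` and `false` is `0`. -/
abbrev Mask (l : ℕ) : Type := Fin l → Bool

variable {n l : ℕ}

/-- The factor `𝗐_j ^ σ_j`. -/
def maskedLetter (w : Fin l → Fin (n - 1)) (σ : Mask l) (j : Fin l) : Equiv.Perm (Fin n) :=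
  if σ j then simple (w j) else 1

/-- `𝗐^{σ[m]}`, the product of the first `m` masked factors, `0 ≤ m ≤ l`. -/
def initialProd (w : Fin l → Fin (n - 1)) (σ : Mask l) (m : Fin (l + 1)) :
    Equiv.Perm (Fin n) :=
  Fin.partialProd (maskedLetter w σ) m

/-- `𝗐^σ`. -/
def maskProd (w : Fin l → Fin (n - 1)) (σ : Mask l) : Equiv.Perm (Fin n) :=
  initialProd w σ (Fin.last l)

/-- Position `j` is a defect: multiplying the masked product of the letters strictly before `j`
by `𝗐_j` on the right goes strictly down in Bruhat order. (The first position never is one.) -/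
def IsDefect (w : Fin l → Fin (n - 1)) (σ : Mask l) (j : Fin l) : Prop :=
  BruhatLT (initialProd w σ j.castSucc * simple (w j)) (initialProd w σ j.castSucc)

/-- `d(σ)`: the number of defects. -/
def numDefects (w : Fin l → Fin (n - 1)) (σ : Mask l) : ℕ :=
  {j | IsDefect w σ j}.ncard

/-- The two signs. -/
inductive Sign : Type
  | plus : Sign
  | minus : Sign

open Classical in
/-- The sign string `e(σ)`: `+` at zero-defects and plain-ones, `-` at plain-zeros and
one-defects. -/
def signString (w : Fin l → Fin (n - 1)) (σ : Mask l) (j : Fin l) : Sign :=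
  if (IsDefect w σ j ∧ σ j = false) ∨ (¬ IsDefect w σ j ∧ σ j = true) then Sign.plus
  else Sign.minus

/-- The number of `+`'s in `e(σ)`. -/
def numPlus (w : Fin l → Fin (n - 1)) (σ : Mask l) : ℕ :=
  {j | signString w σ j = Sign.plus}.ncard

/-! ### Grassmannians and products of Grassmannians -/

/-- `Gr(d, n)`: the `d`-dimensional subspaces of `ℂⁿ`. -/
def Gr (d n : ℕ) : Type :=
  {V : Submodule ℂ (Fin n → ℂ) // Module.finrank ℂ V = d}

/-- Linearly independent `d`-tuples of vectors of `ℂⁿ`. -/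
def Frame (d n : ℕ) : Type :=
  {M : Fin d → Fin n → ℂ // LinearIndependent ℂ M}

/-- The subspace spanned by a linearly independent tuple. -/
def Frame.span {d n : ℕ} (M : Frame d n) : Gr d n :=
  ⟨Submodule.span ℂ (Set.range M.1), by
    have h := finrank_span_eq_card M.2
    rwa [Fintype.card_fin] at h⟩

/-- The classical topology on linearly independent tuples, as an open subset of `ℂ^{dn}`. -/
instance Frame.classicalTopology (d n : ℕ) : TopologicalSpace (Frame d n) :=
  inferInstanceAs
    (TopologicalSpace {M : Fin d → Fin n → ℂ // LinearIndependent ℂ M})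

/-- The classical topology on the Grassmannian `Gr(d, n)`: the quotient topology from linearly
independent tuples. -/
instance Gr.classicalTopology (d n : ℕ) : TopologicalSpace (Gr d n) :=
  TopologicalSpace.coinduced Frame.span inferInstance

/-- The Zariski topology on affine space `ℂ^ι`: the closed sets are the zero loci of ideals of
polynomials. -/
@[reducible]
def zariskiAffine (ι : Type) : TopologicalSpace (ι → ℂ) :=
  TopologicalSpace.ofClosed
    {A | ∃ I : Set (MvPolynomial ι ℂ), A = {x | ∀ f ∈ I, MvPolynomial.eval x f = 0}}
    ⟨{1}, by ext x; simp⟩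
    (by
      intro S hS
      have hS' : ∀ A : Set (ι → ℂ), ∃ I : Set (MvPolynomial ι ℂ), A ∈ S →
          A = {x | ∀ f ∈ I, MvPolynomial.eval x f = 0} := by
        intro A
        by_cases hA : A ∈ S
        · obtain ⟨I, hI⟩ := hS hA
          exact ⟨I, fun _ => hI⟩
        · exact ⟨∅, fun h => absurd h hA⟩
      choose I hI using hS'
      refine ⟨⋃ A ∈ S, I A, ?_⟩
      ext x
      simp only [Set.mem_sInter, Set.mem_iUnion, Set.mem_ofPred_eq, exists_prop]
      constructor
      · rintro h f ⟨A, hA, hf⟩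
        have hx := h A hA
        rw [hI A hA] at hx
        exact hx f hf
      · intro h A hA
        rw [hI A hA]
        exact fun f hf => h f ⟨A, hA, hf⟩)
    (by
      rintro _ ⟨I, rfl⟩ _ ⟨J, rfl⟩
      refine ⟨{h | ∃ f ∈ I, ∃ g ∈ J, h = f * g}, ?_⟩
      ext x
      simp only [Set.mem_union, Set.mem_ofPred_eq]
      constructor
      · rintro (h | h) _ ⟨f, hf, g, hg, rfl⟩
        · simp [h f hf]
        · simp [h g hg]
      · intro h
        by_contra! hc
        obtain ⟨⟨f, hf, hfx⟩, g, hg, hgx⟩ := hc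
        have := h _ ⟨f, hf, g, hg, rfl⟩
        rw [map_mul] at this
        exact (mul_ne_zero hfx hgx) this)

/-- The product `Gr(d_1, n) × ⋯ × Gr(d_l, n)`; a point is a sequence of subspaces
`[V_1, …, V_l]`. It carries the (product) classical topology as an instance. -/
abbrev GrProd {l : ℕ} (d : Fin l → ℕ) (n : ℕ) : Type :=
  (j : Fin l) → Gr (d j) n

/-- The affine coordinates (all matrix entries) of a sequence of linearly independent tuples. -/
def frameCoords {l : ℕ} (d : Fin l → ℕ) (n : ℕ) (M : (j : Fin l) → Frame (d j) n) :
    ((j : Fin l) × (Fin (d j) × Fin n)) → ℂ :=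
  fun x => (M x.1).1 x.2.1 x.2.2

/-- The Zariski topology on `Gr(d_1, n) × ⋯ × Gr(d_l, n)`. Sequences of linearly independent
tuples form an open subset of an affine space, and the product of Grassmannians has the quotient
topology for the map taking spans. -/
@[reducible]
def zariskiGrProd {l : ℕ} (d : Fin l → ℕ) (n : ℕ) : TopologicalSpace (GrProd d n) :=
  TopologicalSpace.coinduced
    (fun (M : (j : Fin l) → Frame (d j) n) (j : Fin l) => (M j).span)
    (TopologicalSpace.induced (frameCoords d n) (zariskiAffine _))

/-- The dimension of a subset of a product of Grassmannians: the Krull dimension of the subspace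
topology induced by the Zariski topology. -/
def zariskiDim {l : ℕ} {d : Fin l → ℕ} {n : ℕ} (C : Set (GrProd d n)) : WithBot ℕ∞ :=
  @topologicalKrullDim C (TopologicalSpace.induced Subtype.val (zariskiGrProd d n))

/-! ### The Bott–Samelson variety -/

/-- The standard subspace `E_i` of `ℂⁿ` spanned by the first `i` standard basis vectors. -/
def stdSubspace (n i : ℕ) : Submodule ℂ (Fin n → ℂ) :=
  Submodule.span ℂ {v | ∃ k : Fin n, (k : ℕ) < i ∧ v = Pi.single k 1}

/-- `d_j`, where `𝗐_j = s_{d_j}` with one-based numbering of the generators. -/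
def colDim (w : Fin l → Fin (n - 1)) (j : Fin l) : ℕ := (w j : ℕ) + 1

/-- The positions before `j` carrying `s_{d_j - 1}`; `lpred(j)` is the greatest of them. -/
def leftBefore (w : Fin l → Fin (n - 1)) (j : Fin l) : Set (Fin l) :=
  {k | k < j ∧ colDim w k + 1 = colDim w j}

/-- The positions before `j` carrying `s_{d_j + 1}`; `rpred(j)` is the greatest of them. -/
def rightBefore (w : Fin l → Fin (n - 1)) (j : Fin l) : Set (Fin l) :=
  {k | k < j ∧ colDim w k = colDim w j + 1}

/-- The Bott–Samelson variety `Z_𝗐`: for every `j`, `V_{lpred(j)} ⊆ V_j ⊆ V_{rpred(j)}`, where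
`V_{lpred(j)}` is replaced by `E_{d_j - 1}` if there is no `lpred(j)`, and `V_{rpred(j)}` by
`E_{d_j + 1}` if there is no `rpred(j)`. -/
def variety (w : Fin l → Fin (n - 1)) : Set (GrProd (colDim w) n) :=
  {V | ∀ j : Fin l,
    (∀ k, IsGreatest (leftBefore w j) k → (V k).1 ≤ (V j).1) ∧
    (leftBefore w j = ∅ → stdSubspace n (colDim w j - 1) ≤ (V j).1) ∧
    (∀ k, IsGreatest (rightBefore w j) k → (V j).1 ≤ (V k).1) ∧
    (rightBefore w j = ∅ → (V j).1 ≤ stdSubspace n (colDim w j + 1))}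

lemma colDim_le (w : Fin l → Fin (n - 1)) (j : Fin l) : colDim w j ≤ n := by
  have := (w j).2
  unfold colDim
  omega

/-- The tuple `(e_{u(1)}, …, e_{u(d)})` for a permutation `u`. -/
def coordFrame {d n : ℕ} (hd : d ≤ n) (u : Equiv.Perm (Fin n)) : Frame d n :=
  ⟨fun k => Pi.single (u (Fin.castLE hd k)) 1, by
    have h := (Pi.basisFun ℂ (Fin n)).linearIndependent.comp
      (fun k : Fin d => u (Fin.castLE hd k))
      (u.injective.comp (Fin.castLE_injective hd))
    convert h using 1
    ext k i
    simp [Pi.basisFun_apply]⟩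

/-- The torus-fixed point `p_σ = [V_1, …, V_l]`,
`V_j = Span(e_{𝗐^{σ[j]}(1)}, …, e_{𝗐^{σ[j]}(d_j)})`. -/
def fixedPoint (w : Fin l → Fin (n - 1)) (σ : Mask l) : GrProd (colDim w) n :=
  fun j => (coordFrame (colDim_le w j) (initialProd w σ j.succ)).span

/-- The action of `t ∈ ℂˣ` on `ℂⁿ`: `t · e_i = t^{n-i} e_i` for one-based `i`. -/
def torusLin (n : ℕ) (t : ℂˣ) : (Fin n → ℂ) ≃ₗ[ℂ] (Fin n → ℂ) :=
  LinearEquiv.piCongrRight fun i => LinearEquiv.smulOfUnit (t ^ (n - ((i : ℕ) + 1)))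

/-- The induced action of `ℂˣ` on `Gr(d, n)`. -/
def torusGr {d n : ℕ} (t : ℂˣ) (V : Gr d n) : Gr d n :=
  ⟨V.1.map (torusLin n t : (Fin n → ℂ) →ₗ[ℂ] (Fin n → ℂ)), by
    rw [LinearEquiv.finrank_map_eq]
    exact V.2⟩

/-- The Białynicki-Birula cell `C_σ = {p ∈ Z_𝗐 | lim_{t → 0} t · p = p_σ}`, for the diagonal
action of `ℂˣ` on sequences of subspaces. -/
def cell (w : Fin l → Fin (n - 1)) (σ : Mask l) : Set (GrProd (colDim w) n) :=
  {V | V ∈ variety w ∧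
    Filter.Tendsto (fun (t : ℂˣ) (j : Fin l) => torusGr t (V j))
      (Filter.comap (fun t : ℂˣ => (t : ℂ)) (nhds 0)) (nhds (fixedPoint w σ))}

end BottSamelson

end

/-!
The statement has a combinatorial and a geometric half; they meet in the observation that position
`j` carries the sign `+` exactly if `𝗐^{σ[j]}` has a descent at `𝗐_j` (`isFree_iff`).

*Signs.* Length equals the number of inversions, so right multiplication by `s_d` changes it by `±1`
according to the order of the values at `d` and `d + 1`, and it goes down in Bruhat order exactly
when it goes down in length (`bruhatLT_mul_simple_iff`). Checking the four cases of a step, the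
length of `𝗐^{σ[j]}` increases by the contribution of `j` to the number of `+`'s minus its
contribution to the number of defects (`length_initialProd_succ`); summing over `j` gives
`numPlus_eq_length_add_numDefects`.

*The cell.* A subspace `V` of dimension `d` tends to `Span(e_{u(1)}, …, e_{u(d)})` under the torus
if and only if it has a basis that is the identity in the columns `u(1), …, u(d)` and in which the
row with pivot `x` vanishes to the right of `x` (`tendsto_torusGr_iff`): the torus multiplies the
entry `y` of this row by `t^{x-y}`. A point of the Bott–Samelson variety is a sequence of complete
flags starting at the standard one, step `j` of which changes only the member of dimension `d_j`
(`mem_variety_iff`). If the flags before and after step `j` both have the prescribed pivots, let `p`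
be the new pivot of `V_j` and `q` the pivot of the next larger member that `V_j` misses; then `V_j`
is spanned by the next smaller member and `b_p + c b_q`, where `b` is the normalised basis of the
larger member. The coordinate `c` is the entry `(p, q)` of the normalised basis of `V_j`. It is
arbitrary if `q < p`, that is, if `𝗐^{σ[j]}` has a descent at `𝗐_j`, and zero otherwise
(`IsStep.eq_newRows`). So the cell is parametrised bijectively by the affine space whose coordinates
are the positions with sign `+` (`range_param`, `param_injective`).

*Dimension.* The parametrisation is polynomial, and its inverse reads off entries of normalised
bases, which are regular functions on a chart of the product of Grassmannians. Hence it is an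
embedding for the Zariski topologies (`isEmbedding_param`), and the dimension of the cell is that of
affine space, which by the Nullstellensatz is the Krull dimension of a polynomial ring
(`topologicalKrullDim_zariskiAffine`).
-/

noncomputable section

namespace BottSamelson

/-! ### Length and descents -/

section Length

variable {n : ℕ}

/-- The letter `i` as a position, so that `simple i` exchanges `lo i` and `hi i`. -/
def lo (i : Fin (n - 1)) : Fin n := ⟨i, by omega⟩

/-- The position following `lo i`. -/
def hi (i : Fin (n - 1)) : Fin n := ⟨i + 1, by omega⟩

lemma lo_lt_hi (i : Fin (n - 1)) : lo i < hi i := by simp [lo, hi, Fin.lt_def]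

lemma simple_eq_swap (i : Fin (n - 1)) : simple i = Equiv.swap (lo i) (hi i) := rfl

lemma simple_mul_self (i : Fin (n - 1)) : simple i * simple i = 1 := Equiv.swap_mul_self _ _

lemma simple_lo (i : Fin (n - 1)) : simple i (lo i) = hi i := Equiv.swap_apply_left _ _

lemma simple_hi (i : Fin (n - 1)) : simple i (hi i) = lo i := Equiv.swap_apply_right _ _

lemma simple_simple (i : Fin (n - 1)) (x : Fin n) : simple i (simple i x) = x :=
  Equiv.swap_apply_self _ _ _

/-- An adjacent transposition preserves the order of every pair except the one it exchanges. -/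
lemma simple_lt_simple (i : Fin (n - 1)) {a b : Fin n} (hab : a < b)
    (h : ¬ (a = lo i ∧ b = hi i)) : simple i a < simple i b := by
  simp only [simple_eq_swap, Equiv.swap_apply_def, lo, hi, Fin.lt_def, Fin.ext_iff] at *
  split_ifs <;> (try dsimp only) <;> omega

/-- The inversions of `u`, as pairs of positions. -/
def inversions (u : Equiv.Perm (Fin n)) : Finset (Fin n × Fin n) :=
  {x | x.1 < x.2 ∧ u x.2 < u x.1}

lemma mem_inversions {u : Equiv.Perm (Fin n)} {a b : Fin n} :
    (a, b) ∈ inversions u ↔ a < b ∧ u b < u a := by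
  rw [inversions, Finset.mem_filter]
  simp

lemma card_inversions_mul_simple {u : Equiv.Perm (Fin n)} {i : Fin (n - 1)}
    (h : u (lo i) < u (hi i)) :
    (inversions (u * simple i)).card = (inversions u).card + 1 := by
  have hmem : (lo i, hi i) ∈ inversions (u * simple i) := by
    simp [mem_inversions, lo_lt_hi, simple_lo, simple_hi, h]
  rw [← Finset.card_erase_add_one hmem]
  congr 1
  -- away from the exchanged pair, `simple i` matches the inversions of `u * simple i` and `u`
  refine Finset.card_nbij' (fun x => (simple i x.1, simple i x.2))
    (fun x => (simple i x.1, simple i x.2)) ?_ ?_ ?_ ?_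
  · rintro ⟨a, b⟩ hx
    simp only [Finset.coe_erase, Set.mem_sdiff, Finset.mem_coe, mem_inversions,
      Set.mem_singleton_iff, Prod.mk.injEq, Equiv.Perm.mul_apply] at hx ⊢
    exact ⟨simple_lt_simple i hx.1.1 hx.2, hx.1.2⟩
  · rintro ⟨a, b⟩ hx
    simp only [Finset.coe_erase, Set.mem_sdiff, Finset.mem_coe, mem_inversions,
      Set.mem_singleton_iff, Prod.mk.injEq, Equiv.Perm.mul_apply,
      simple_simple] at hx ⊢
    refine ⟨⟨simple_lt_simple i hx.1 ?_, hx.2⟩, ?_⟩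
    · rintro ⟨rfl, rfl⟩
      exact lt_asymm h hx.2
    · rintro ⟨h1, h2⟩
      have h1' : a = hi i := by rw [← simple_simple i a, h1, simple_lo]
      have h2' : b = lo i := by rw [← simple_simple i b, h2, simple_hi]
      subst h1' h2'
      exact lt_asymm (lo_lt_hi i) hx.1
  · rintro ⟨a, b⟩ _; simp [simple_simple]
  · rintro ⟨a, b⟩ _; simp [simple_simple]

lemma mul_simple_mul_simple (u : Equiv.Perm (Fin n)) (i : Fin (n - 1)) :
    u * simple i * simple i = u := by
  rw [mul_assoc, simple_mul_self, mul_one]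

lemma card_inversions_of_gt {u : Equiv.Perm (Fin n)} {i : Fin (n - 1)}
    (h : u (hi i) < u (lo i)) :
    (inversions u).card = (inversions (u * simple i)).card + 1 := by
  conv_lhs => rw [← mul_simple_mul_simple u i]
  apply card_inversions_mul_simple
  simpa [simple_lo, simple_hi] using h

lemma lo_or_hi (u : Equiv.Perm (Fin n)) (i : Fin (n - 1)) :
    u (lo i) < u (hi i) ∨ u (hi i) < u (lo i) :=
  lt_or_gt_of_ne (fun h => (lo_lt_hi i).ne (u.injective h))

lemma eq_one_of_forall_lt {u : Equiv.Perm (Fin n)}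
    (h : ∀ i : Fin (n - 1), u (lo i) < u (hi i)) : u = 1 := by
  have hmono : StrictMono u := by
    rcases n with _ | n
    · exact fun a => a.elim0
    · exact Fin.strictMono_iff_lt_succ.2 fun i => h i
  let e : Fin n ≃o Fin n := hmono.orderIsoOfSurjective u u.surjective
  have : e = OrderIso.refl _ := Subsingleton.elim _ _
  ext x
  exact congrArg Fin.val (DFunLike.congr_fun this x)

lemma wordProd_append_singleton (a : List (Fin (n - 1))) (i : Fin (n - 1)) :
    wordProd (a ++ [i]) = wordProd a * simple i := by
  simp [wordProd]

lemma card_inversions_one : (inversions (1 : Equiv.Perm (Fin n))).card = 0 := by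
  simp only [inversions, Finset.card_eq_zero, Finset.filter_eq_empty_iff]
  rintro ⟨a, b⟩ -
  simpa using fun h : a < b => h.le

lemma card_inversions_wordProd_le (a : List (Fin (n - 1))) :
    (inversions (wordProd a)).card ≤ a.length := by
  induction a using List.reverseRecOn with
  | nil => simp [wordProd, card_inversions_one]
  | append_singleton a i ih =>
    rw [wordProd_append_singleton, List.length_append, List.length_singleton]
    rcases lo_or_hi (wordProd a) i with h | h
    · rw [card_inversions_mul_simple h]; omega
    · have := card_inversions_of_gt h; omega

lemma exists_word_length_eq (u : Equiv.Perm (Fin n)) :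
    ∃ a : List (Fin (n - 1)), wordProd a = u ∧ a.length = (inversions u).card := by
  induction hk : (inversions u).card using Nat.strong_induction_on generalizing u with
  | _ k ih =>
  by_cases hdesc : ∃ i : Fin (n - 1), u (hi i) < u (lo i)
  · obtain ⟨i, hi'⟩ := hdesc
    have hc := card_inversions_of_gt hi'
    obtain ⟨a, ha, hl⟩ := ih _ (by omega) (u * simple i) rfl
    exact ⟨a ++ [i], by rw [wordProd_append_singleton, ha, mul_simple_mul_simple],
      by rw [List.length_append, List.length_singleton]; omega⟩
  · push Not at hdesc
    have h1 : u = 1 := eq_one_of_forall_lt fun i =>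
      lt_of_le_of_ne (hdesc i) (fun h => (lo_lt_hi i).ne (u.injective h))
    subst h1
    rw [card_inversions_one] at hk
    exact ⟨[], by simp [wordProd], by simpa using hk⟩

lemma length_eq_card_inversions (u : Equiv.Perm (Fin n)) :
    length u = (inversions u).card := by
  apply le_antisymm
  · exact Nat.sInf_le (exists_word_length_eq u)
  · refine le_csInf ?_ ?_
    · exact ⟨_, exists_word_length_eq u⟩
    rintro k ⟨a, rfl, rfl⟩
    exact card_inversions_wordProd_le a

lemma length_mul_simple_of_lt {u : Equiv.Perm (Fin n)} {i : Fin (n - 1)}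
    (h : u (lo i) < u (hi i)) : length (u * simple i) = length u + 1 := by
  simpa only [length_eq_card_inversions] using card_inversions_mul_simple h

lemma length_eq_of_gt {u : Equiv.Perm (Fin n)} {i : Fin (n - 1)}
    (h : u (hi i) < u (lo i)) : length u = length (u * simple i) + 1 := by
  simpa only [length_eq_card_inversions] using card_inversions_of_gt h

lemma length_le_of_bruhatLE {x y : Equiv.Perm (Fin n)} (h : BruhatLE x y) :
    length x ≤ length y := by
  obtain ⟨a, b, ha, hb, rfl, rfl, hs⟩ := h
  rw [← ha, ← hb]
  exact hs.length_le

/-- Right multiplication by `simple i` goes down in Bruhat order exactly at the descents. -/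
lemma bruhatLT_mul_simple_iff (u : Equiv.Perm (Fin n)) (i : Fin (n - 1)) :
    BruhatLT (u * simple i) u ↔ u (hi i) < u (lo i) := by
  constructor
  · rintro ⟨hle, -⟩
    by_contra h
    have h' := (lo_or_hi u i).resolve_right h
    have := length_le_of_bruhatLE hle
    rw [length_mul_simple_of_lt h'] at this
    omega
  · intro h
    have hlen := length_eq_of_gt h
    obtain ⟨a, ha, hal⟩ := exists_word_length_eq (u * simple i)
    rw [← length_eq_card_inversions] at hal
    have hb : wordProd (a ++ [i]) = u := by
      rw [wordProd_append_singleton, ha, mul_simple_mul_simple]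
    refine ⟨⟨a, a ++ [i], by rw [IsReduced, ha, hal], ?_, ha, hb, List.sublist_append_left _ _⟩, ?_⟩
    · rw [IsReduced, hb, List.length_append, List.length_singleton, hlen, hal]
    · intro he
      rw [he] at hlen
      omega

end Length

/-! ### The sign string -/

section Signs

variable {n l : ℕ} (w : Fin l → Fin (n - 1)) (σ : Mask l)

lemma initialProd_zero : initialProd w σ 0 = 1 := Fin.partialProd_zero _

lemma initialProd_succ (j : Fin l) :
    initialProd w σ j.succ = initialProd w σ j.castSucc * maskedLetter w σ j :=
  Fin.partialProd_succ _ _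

lemma isDefect_iff (j : Fin l) :
    IsDefect w σ j ↔
      initialProd w σ j.castSucc (hi (w j)) < initialProd w σ j.castSucc (lo (w j)) :=
  bruhatLT_mul_simple_iff _ _

/-- Position `j` is free if `𝗐^{σ[j]}` has a descent at `𝗐_j`. These are the positions with sign
`+`, and they index the coordinates of the cell. -/
def IsFree (j : Fin l) : Prop :=
  initialProd w σ j.succ (hi (w j)) < initialProd w σ j.succ (lo (w j))

lemma isFree_iff (j : Fin l) :
    IsFree w σ j ↔ (IsDefect w σ j ∧ σ j = false) ∨ (¬ IsDefect w σ j ∧ σ j = true) := by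
  rw [IsFree, isDefect_iff, initialProd_succ, maskedLetter]
  cases σ j
  · simp
  · have := lo_or_hi (initialProd w σ j.castSucc) (w j)
    simp only [if_true, Equiv.Perm.mul_apply, simple_lo, simple_hi]
    constructor
    · intro h
      exact Or.inr ⟨lt_asymm h, trivial⟩
    · rintro (h | h)
      · simp at h
      · exact this.resolve_right h.1

lemma signString_eq_plus_iff (j : Fin l) : signString w σ j = Sign.plus ↔ IsFree w σ j := by
  rw [isFree_iff, signString]
  split_ifs with h <;> simp [h]

lemma numPlus_eq_natCard : numPlus w σ = Nat.card {j // IsFree w σ j} := by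
  rw [numPlus, ← Nat.card_coe_set_eq]
  simp only [signString_eq_plus_iff]
  rfl

open Classical in
/-- One step changes the length by the sign contribution minus the defect contribution. -/
lemma length_initialProd_succ (j : Fin l) :
    length (initialProd w σ j.succ) + (if IsDefect w σ j then 1 else 0) =
      length (initialProd w σ j.castSucc) + (if IsFree w σ j then 1 else 0) := by
  rw [isFree_iff]
  simp only [isDefect_iff]
  rw [initialProd_succ, maskedLetter]
  set u := initialProd w σ j.castSucc
  rcases lo_or_hi u (w j) with h | h
  · have := length_mul_simple_of_lt h
    cases σ j <;> simp [h.not_gt, this]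
  · have := length_eq_of_gt h
    cases σ j <;> simp [h, this]

theorem numPlus_eq_length_add_numDefects :
    numPlus w σ = length (maskProd w σ) + numDefects w σ := by
  classical
  have key : ∀ m : Fin (l + 1),
      length (initialProd w σ m) + ({j | j.castSucc < m ∧ IsDefect w σ j} : Finset (Fin l)).card =
        ({j | j.castSucc < m ∧ IsFree w σ j} : Finset (Fin l)).card := by
    intro m
    induction m using Fin.induction with
    | zero =>
      have h1 : length (initialProd w σ 0) = 0 := by
        rw [initialProd_zero, length_eq_card_inversions, card_inversions_one]
      simp [h1]
    | succ j ih =>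
      have hcard : ∀ P : Fin l → Prop,
          ({k | k.castSucc < j.succ ∧ P k} : Finset (Fin l)).card =
            ({k | k.castSucc < j.castSucc ∧ P k} : Finset (Fin l)).card +
              if P j then 1 else 0 := by
        intro P
        have hsplit : ({k | k.castSucc < j.succ ∧ P k} : Finset (Fin l)) =
            ({k | k.castSucc < j.castSucc ∧ P k} : Finset (Fin l)) ∪
              (if P j then {j} else ∅) := by
          ext k
          simp only [Finset.mem_filter, Finset.mem_univ, true_and, Finset.mem_union,
            Fin.castSucc_lt_succ_iff, Fin.castSucc_lt_castSucc_iff, le_iff_lt_or_eq]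
          split_ifs with hP
          · simp only [Finset.mem_singleton]
            constructor
            · rintro ⟨h | h, h'⟩
              · exact Or.inl ⟨h, h'⟩
              · exact Or.inr h
            · rintro (h | rfl)
              · exact ⟨Or.inl h.1, h.2⟩
              · exact ⟨Or.inr rfl, hP⟩
          · simp only [Finset.notMem_empty, or_false]
            constructor
            · rintro ⟨h | rfl, h'⟩
              · exact ⟨h, h'⟩
              · exact absurd h' hP
            · exact fun h => ⟨Or.inl h.1, h.2⟩
        rw [hsplit, Finset.card_union_of_disjoint]
        · split_ifs <;> simp
        · split_ifs <;> simp
      rw [hcard, hcard, ← ih]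
      have := length_initialProd_succ w σ j
      omega
  have hlast := key (Fin.last l)
  simp only [Fin.castSucc_lt_last, true_and] at hlast
  rw [numPlus_eq_natCard, numDefects, Nat.card_eq_fintype_card, Fintype.card_subtype, maskProd,
    ← hlast, Set.ncard_eq_toFinset_card']
  simp

end Signs

/-! ### The Krull dimension of affine space -/

section AffineSpace

open MvPolynomial Topology

lemma isClosed_zariskiAffine_iff {ι : Type} (A : Set (ι → ℂ)) :
    IsClosed[zariskiAffine ι] A ↔
      ∃ I : Set (MvPolynomial ι ℂ), A = {x | ∀ f ∈ I, MvPolynomial.eval x f = 0} := by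
  rw [← @isOpen_compl_iff _ _ (zariskiAffine ι)]
  change Aᶜᶜ ∈ _ ↔ _
  rw [compl_compl]
  rfl

lemma isClosed_zeroLocus {ι : Type} (I : Ideal (MvPolynomial ι ℂ)) :
    IsClosed[zariskiAffine ι] (zeroLocus ℂ I) :=
  (isClosed_zariskiAffine_iff _).2 ⟨I, by ext x; simp [aeval_eq_eval]⟩

lemma zeroLocus_vanishingIdeal_of_isClosed {ι : Type} {A : Set (ι → ℂ)}
    (hA : IsClosed[zariskiAffine ι] A) :
    zeroLocus ℂ (vanishingIdeal ℂ A) = A := by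
  obtain ⟨I, rfl⟩ := (isClosed_zariskiAffine_iff _).1 hA
  refine subset_antisymm (fun x hx f hf => ?_) (zeroLocus_vanishingIdeal_le _)
  have := hx f (fun y hy => by simpa [aeval_eq_eval] using hy f hf)
  simpa [aeval_eq_eval] using this

lemma isIrreducible_iff_isPrime_vanishingIdeal {ι : Type} {A : Set (ι → ℂ)}
    (hA : IsClosed[zariskiAffine ι] A) :
    @IsIrreducible _ (zariskiAffine ι) A ↔ (vanishingIdeal ℂ A).IsPrime := by
  let _ := zariskiAffine ι
  constructor
  · rintro ⟨⟨a, ha⟩, hirr⟩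
    rw [isPreirreducible_iff_isClosed_union_isClosed] at hirr
    refine ⟨?_, ?_⟩
    · rw [Ideal.ne_top_iff_one]
      intro h
      simpa using h a ha
    · intro f g hfg
      have key : ∀ f : MvPolynomial ι ℂ, IsClosed {x | eval x f = 0} := fun f =>
        (isClosed_zariskiAffine_iff _).2 ⟨{f}, by simp⟩
      rcases hirr _ _ (key f) (key g) (fun x hx => by
        have := hfg x hx
        simpa [aeval_eq_eval] using this) with h | h
      · left; intro x hx; simpa [aeval_eq_eval] using h hx
      · right; intro x hx; simpa [aeval_eq_eval] using h hx
  · intro hp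
    refine ⟨?_, ?_⟩
    · rw [Set.nonempty_iff_ne_empty]
      rintro rfl
      exact hp.ne_top (vanishingIdeal_empty)
    · rw [isPreirreducible_iff_isClosed_union_isClosed]
      intro B D hB hD hAB
      by_contra! hc
      obtain ⟨⟨x, hxA, hxB⟩, ⟨y, hyA, hyD⟩⟩ := And.intro
        (Set.not_subset.1 hc.1) (Set.not_subset.1 hc.2)
      obtain ⟨I, rfl⟩ := (isClosed_zariskiAffine_iff _).1 hB
      obtain ⟨J, rfl⟩ := (isClosed_zariskiAffine_iff _).1 hD
      simp only [Set.mem_ofPred_eq, not_forall] at hxB hyD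
      obtain ⟨f, hf, hfx⟩ := hxB
      obtain ⟨g, hg, hgy⟩ := hyD
      rcases hp.mem_or_mem (x := f) (y := g) (fun z hz => by
        rcases hAB hz with h | h
        · simp [aeval_eq_eval, h f hf]
        · simp [aeval_eq_eval, h g hg]) with h | h
      · exact hfx (by simpa [aeval_eq_eval] using h x hxA)
      · exact hgy (by simpa [aeval_eq_eval] using h y hyA)

/-- The order-reversing correspondence between irreducible closed subsets of the affine space `ℂ^ι`,
regarded as a space of closed points only, and prime ideals of its polynomial ring. -/
def irreducibleClosedsOrderIso (ι : Type) [Finite ι] :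
    @TopologicalSpace.IrreducibleCloseds _ (zariskiAffine ι) ≃o
      (PrimeSpectrum (MvPolynomial ι ℂ))ᵒᵈ :=
  let _ := zariskiAffine ι
  { toFun := fun A => OrderDual.toDual
      ⟨vanishingIdeal ℂ A.1, (isIrreducible_iff_isPrime_vanishingIdeal A.3).1 A.2⟩
    invFun := fun P =>
      ⟨zeroLocus ℂ (OrderDual.ofDual P).1,
        (isIrreducible_iff_isPrime_vanishingIdeal (isClosed_zeroLocus _)).2 (by
          have := (OrderDual.ofDual P).2
          rw [IsPrime.vanishingIdeal_zeroLocus]; exact this),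
        isClosed_zeroLocus _⟩
    left_inv := fun A => TopologicalSpace.IrreducibleCloseds.ext
      (zeroLocus_vanishingIdeal_of_isClosed A.3)
    right_inv := fun P => by
      have := (OrderDual.ofDual P).2
      apply OrderDual.ofDual.injective
      apply PrimeSpectrum.ext
      exact IsPrime.vanishingIdeal_zeroLocus _
    map_rel_iff' := by
      intro A B
      change vanishingIdeal ℂ B.1 ≤ vanishingIdeal ℂ A.1 ↔ A.1 ⊆ B.1
      refine ⟨fun h => ?_, fun h => vanishingIdeal_anti_mono h⟩
      rw [← zeroLocus_vanishingIdeal_of_isClosed A.3, ← zeroLocus_vanishingIdeal_of_isClosed B.3]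
      exact zeroLocus_anti_mono h }

lemma topologicalKrullDim_zariskiAffine (ι : Type) [Finite ι] :
    @topologicalKrullDim (ι → ℂ) (zariskiAffine ι) = ((Nat.card ι : ℕ) : WithBot ℕ∞) := by
  let _ := zariskiAffine ι
  unfold topologicalKrullDim
  rw [Order.krullDim_eq_of_orderIso (irreducibleClosedsOrderIso ι), Order.krullDim_orderDual]
  change ringKrullDim _ = _
  rw [MvPolynomial.ringKrullDim_of_isNoetherianRing]
  simp

end AffineSpace

/-! ### Normalised bases of subspaces -/

section NormalBasis

variable {n d : ℕ}

/-- The set `{u(1), …, u(i)}` of the coordinates at which the subspace spanned by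
`e_{u(1)}, …, e_{u(i)}` has its pivots. -/
def pivots (u : Equiv.Perm (Fin n)) (i : ℕ) : Finset (Fin n) := {x | (u.symm x : ℕ) < i}

lemma mem_pivots {u : Equiv.Perm (Fin n)} {i : ℕ} {x : Fin n} :
    x ∈ pivots u i ↔ (u.symm x : ℕ) < i := by
  simp [pivots]

lemma apply_castLE_mem_pivots (hd : d ≤ n) (u : Equiv.Perm (Fin n)) (r : Fin d) :
    u (Fin.castLE hd r) ∈ pivots u d := by
  simp [mem_pivots]

lemma exists_of_mem_pivots (hd : d ≤ n) {u : Equiv.Perm (Fin n)} {x : Fin n}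
    (hx : x ∈ pivots u d) : ∃ r : Fin d, u (Fin.castLE hd r) = x :=
  ⟨⟨u.symm x, mem_pivots.1 hx⟩, by
    have : Fin.castLE hd ⟨u.symm x, mem_pivots.1 hx⟩ = u.symm x := rfl
    rw [this, Equiv.apply_symm_apply]⟩

lemma sum_pivots (hd : d ≤ n) (u : Equiv.Perm (Fin n)) {E : Type*} [AddCommMonoid E]
    (f : Fin n → E) : ∑ x ∈ pivots u d, f x = ∑ r : Fin d, f (u (Fin.castLE hd r)) := by
  symm
  refine Finset.sum_bij (fun r _ => u (Fin.castLE hd r))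
    (fun r _ => apply_castLE_mem_pivots hd u r)
    (fun r _ s _ h => Fin.castLE_injective hd (u.injective h)) ?_ (fun _ _ => rfl)
  intro x hx
  obtain ⟨r, hr⟩ := exists_of_mem_pivots hd hx
  exact ⟨r, Finset.mem_univ _, hr⟩

/-- The rows `b x`, `x ∈ I`, form an identity matrix in the columns `I`. -/
def IsUnitBlock (I : Finset (Fin n)) (b : Fin n → Fin n → ℂ) : Prop :=
  ∀ x ∈ I, ∀ y ∈ I, b x y = if x = y then 1 else 0

/-- The row `b x`, `x ∈ I`, has no entry to the right of its pivot `x`. -/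
def IsEchelon (I : Finset (Fin n)) (b : Fin n → Fin n → ℂ) : Prop :=
  ∀ x ∈ I, ∀ y, x < y → b x y = 0

/-- The span of the rows `b x`, `x ∈ I`. -/
def rowSpan (I : Finset (Fin n)) (b : Fin n → Fin n → ℂ) : Submodule ℂ (Fin n → ℂ) :=
  Submodule.span ℂ (b '' I)

/-- The rows `b x`, `x ∈ I`, form the basis of `V` that is normalised to be the identity in the
columns `I`. Rows `b x` with `x ∉ I` are irrelevant. -/
structure IsNormalBasis (I : Finset (Fin n)) (V : Submodule ℂ (Fin n → ℂ))
    (b : Fin n → Fin n → ℂ) : Prop where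
  mem : ∀ x ∈ I, b x ∈ V
  unit : IsUnitBlock I b
  repr : ∀ v ∈ V, v = ∑ x ∈ I, v x • b x

lemma row_mem_rowSpan {I : Finset (Fin n)} (b : Fin n → Fin n → ℂ) {x : Fin n} (hx : x ∈ I) :
    b x ∈ rowSpan I b :=
  Submodule.subset_span ⟨x, hx, rfl⟩

lemma rowSpan_le {I : Finset (Fin n)} {b : Fin n → Fin n → ℂ} {V : Submodule ℂ (Fin n → ℂ)} :
    rowSpan I b ≤ V ↔ ∀ x ∈ I, b x ∈ V := by
  rw [rowSpan, Submodule.span_le, Set.image_subset_iff]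
  rfl

lemma IsUnitBlock.isNormalBasis {I : Finset (Fin n)} {b : Fin n → Fin n → ℂ}
    (h : IsUnitBlock I b) : IsNormalBasis I (rowSpan I b) b where
  mem _ hx := row_mem_rowSpan b hx
  unit := h
  repr v hv := by
    induction hv using Submodule.span_induction with
    | mem v hv =>
      obtain ⟨x, hx, rfl⟩ := hv
      rw [Finset.sum_eq_single_of_mem x hx, h x hx x hx, if_pos rfl, one_smul]
      intro y hy hyx
      rw [h x hx y hy, if_neg hyx.symm, zero_smul]
    | zero => simp
    | add v v' _ _ ih ih' =>
      conv_lhs => rw [ih, ih']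
      simp only [Pi.add_apply, add_smul, Finset.sum_add_distrib]
    | smul a v _ ih =>
      conv_lhs => rw [ih]
      simp only [Pi.smul_apply, smul_assoc, Finset.smul_sum]

lemma IsNormalBasis.eq_rowSpan {I : Finset (Fin n)} {V : Submodule ℂ (Fin n → ℂ)}
    {b : Fin n → Fin n → ℂ} (h : IsNormalBasis I V b) : V = rowSpan I b := by
  refine le_antisymm (fun v hv => ?_) (rowSpan_le.2 h.mem)
  rw [h.repr v hv]
  exact Submodule.sum_mem _ fun x hx => Submodule.smul_mem _ _ (row_mem_rowSpan b hx)

/-- A normalised basis is determined by its subspace: a vector of `V` is a basis row as soon as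
it looks like one in the columns `I`. -/
lemma IsNormalBasis.eq_row {I : Finset (Fin n)} {V : Submodule ℂ (Fin n → ℂ)}
    {b : Fin n → Fin n → ℂ} (h : IsNormalBasis I V b) {x : Fin n} (hx : x ∈ I) {v : Fin n → ℂ}
    (hv : v ∈ V) (hvI : ∀ y ∈ I, v y = if x = y then 1 else 0) : v = b x := by
  rw [h.repr v hv, Finset.sum_eq_single_of_mem x hx, hvI x hx, if_pos rfl, one_smul]
  intro y hy hyx
  rw [hvI y hy, if_neg hyx.symm, zero_smul]

lemma IsNormalBasis.row_congr {I : Finset (Fin n)} {V : Submodule ℂ (Fin n → ℂ)}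
    {b b' : Fin n → Fin n → ℂ} (h : IsNormalBasis I V b) (h' : IsNormalBasis I V b')
    {x : Fin n} (hx : x ∈ I) : b' x = b x :=
  h.eq_row hx (h'.mem x hx) (h'.unit x hx)

lemma IsUnitBlock.linearIndependent (hd : d ≤ n) {u : Equiv.Perm (Fin n)}
    {b : Fin n → Fin n → ℂ} (h : IsUnitBlock (pivots u d) b) :
    LinearIndependent ℂ (fun r : Fin d => b (u (Fin.castLE hd r))) := by
  rw [Fintype.linearIndependent_iff]
  intro g hg s
  have := congrFun hg (u (Fin.castLE hd s))
  rw [Finset.sum_apply, Finset.sum_eq_single_of_mem s (Finset.mem_univ _)] at this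
  · simpa [h _ (apply_castLE_mem_pivots hd u s) _ (apply_castLE_mem_pivots hd u s)] using this
  · intro r _ hrs
    have hne : u (Fin.castLE hd r) ≠ u (Fin.castLE hd s) := fun he =>
      hrs (Fin.castLE_injective hd (u.injective he))
    simp [h _ (apply_castLE_mem_pivots hd u r) _ (apply_castLE_mem_pivots hd u s), hne]

/-- The frame formed by the rows of a normalised basis, in the order given by `u`. -/
def normalFrame (hd : d ≤ n) (u : Equiv.Perm (Fin n)) (b : Fin n → Fin n → ℂ)
    (h : IsUnitBlock (pivots u d) b) : Frame d n :=
  ⟨fun r => b (u (Fin.castLE hd r)), h.linearIndependent hd⟩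

lemma span_normalFrame (hd : d ≤ n) (u : Equiv.Perm (Fin n)) (b : Fin n → Fin n → ℂ)
    (h : IsUnitBlock (pivots u d) b) : (normalFrame hd u b h).span.1 = rowSpan (pivots u d) b := by
  change Submodule.span ℂ (Set.range fun r : Fin d => b (u (Fin.castLE hd r))) = _
  rw [rowSpan]
  congr 1
  ext v
  constructor
  · rintro ⟨r, rfl⟩
    exact ⟨_, apply_castLE_mem_pivots hd u r, rfl⟩
  · rintro ⟨x, hx, rfl⟩
    obtain ⟨r, rfl⟩ := exists_of_mem_pivots hd hx
    exact ⟨r, rfl⟩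

/-- The square block of a frame in the pivot columns. -/
def Frame.minor (hd : d ≤ n) (u : Equiv.Perm (Fin n)) (M : Frame d n) :
    Matrix (Fin d) (Fin d) ℂ :=
  Matrix.of fun r c => M.1 r (u (Fin.castLE hd c))

lemma Frame.mem_span_iff {M : Frame d n} {v : Fin n → ℂ} :
    v ∈ M.span.1 ↔ ∃ a : Fin d → ℂ, ∑ r, a r • M.1 r = v :=
  Submodule.mem_span_range_iff_exists_fun ℂ

lemma Frame.row_mem_span (M : Frame d n) (r : Fin d) : M.1 r ∈ M.span.1 :=
  Submodule.subset_span ⟨r, rfl⟩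

/-- If the span of a frame has a normalised basis, then the frame is the product of its pivot
block with that basis. -/
lemma IsNormalBasis.minor_mul (hd : d ≤ n) {u : Equiv.Perm (Fin n)} {M : Frame d n}
    {b : Fin n → Fin n → ℂ} (h : IsNormalBasis (pivots u d) M.span.1 b) :
    Matrix.of M.1 = M.minor hd u * Matrix.of fun c : Fin d => b (u (Fin.castLE hd c)) := by
  ext r y
  have := congrFun (h.repr _ (M.row_mem_span r)) y
  rw [sum_pivots hd, Finset.sum_apply] at this
  simpa [Matrix.mul_apply, Frame.minor] using this

lemma IsNormalBasis.det_minor_ne_zero (hd : d ≤ n) {u : Equiv.Perm (Fin n)} {M : Frame d n}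
    {b : Fin n → Fin n → ℂ} (h : IsNormalBasis (pivots u d) M.span.1 b) :
    (M.minor hd u).det ≠ 0 := by
  intro h0
  obtain ⟨a, ha0, ha⟩ := Matrix.exists_vecMul_eq_zero_iff.2 h0
  apply ha0
  have hM : Matrix.vecMul a (Matrix.of M.1) = 0 := by
    rw [h.minor_mul hd, ← Matrix.vecMul_vecMul, ha, Matrix.zero_vecMul]
  funext r
  refine Fintype.linearIndependent_iff.1 M.2 a ?_ r
  funext y
  simpa [Matrix.vecMul, dotProduct, Finset.sum_apply] using congrFun hM y

lemma IsNormalBasis.inv_minor_mul (hd : d ≤ n) {u : Equiv.Perm (Fin n)} {M : Frame d n}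
    {b : Fin n → Fin n → ℂ} (h : IsNormalBasis (pivots u d) M.span.1 b) (r : Fin d) (y : Fin n) :
    ((M.minor hd u)⁻¹ * Matrix.of M.1) r y = b (u (Fin.castLE hd r)) y := by
  rw [h.minor_mul hd, ← Matrix.mul_assoc, Matrix.nonsing_inv_mul _
    (isUnit_iff_ne_zero.2 (h.det_minor_ne_zero hd)), Matrix.one_mul]
  rfl

/-- The normalised rows of a frame, extended by zero to all indices. -/
def Frame.normalRows (hd : d ≤ n) (u : Equiv.Perm (Fin n)) (M : Frame d n) :
    Fin n → Fin n → ℂ :=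
  fun x => if h : (u.symm x : ℕ) < d then
    ((M.minor hd u)⁻¹ * Matrix.of M.1) ⟨u.symm x, h⟩ else 0

lemma Frame.normalRows_apply (hd : d ≤ n) (u : Equiv.Perm (Fin n)) (M : Frame d n) (r : Fin d) :
    M.normalRows hd u (u (Fin.castLE hd r)) = ((M.minor hd u)⁻¹ * Matrix.of M.1) r := by
  simp [Frame.normalRows]

lemma Frame.isNormalBasis_normalRows (hd : d ≤ n) {u : Equiv.Perm (Fin n)} {M : Frame d n}
    (h : (M.minor hd u).det ≠ 0) :
    IsNormalBasis (pivots u d) M.span.1 (M.normalRows hd u) := by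
  have hu : IsUnit (M.minor hd u).det := isUnit_iff_ne_zero.2 h
  refine ⟨?_, ?_, ?_⟩
  · intro x hx
    obtain ⟨r, rfl⟩ := exists_of_mem_pivots hd hx
    rw [Frame.normalRows_apply]
    refine Frame.mem_span_iff.2 ⟨(M.minor hd u)⁻¹ r, ?_⟩
    funext y
    simp [Matrix.mul_apply]
  · intro x hx y hy
    obtain ⟨r, rfl⟩ := exists_of_mem_pivots hd hx
    obtain ⟨s, rfl⟩ := exists_of_mem_pivots hd hy
    rw [Frame.normalRows_apply]
    have := congrFun (congrFun (Matrix.nonsing_inv_mul _ hu) r) s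
    rw [Matrix.one_apply] at this
    simp only [EmbeddingLike.apply_eq_iff_eq, (Fin.castLE_injective hd).eq_iff]
    rw [← this]
    simp [Matrix.mul_apply, Frame.minor]
  · intro v hv
    obtain ⟨a, rfl⟩ := Frame.mem_span_iff.1 hv
    rw [sum_pivots hd]
    simp only [Frame.normalRows_apply]
    have h1 : Matrix.vecMul a (Matrix.of M.1) = Matrix.vecMul (Matrix.vecMul a (M.minor hd u))
        ((M.minor hd u)⁻¹ * Matrix.of M.1) := by
      rw [Matrix.vecMul_vecMul, ← Matrix.mul_assoc, Matrix.mul_nonsing_inv _ hu, Matrix.one_mul]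
    funext y
    have h2 := congrFun h1 y
    simpa [Matrix.vecMul, dotProduct, Finset.sum_apply, Frame.minor] using h2

end NormalBasis

/-! ### Limits under the torus action -/

section Limits

open Topology Filter

variable {n d : ℕ}

lemma torusLin_apply (t : ℂˣ) (v : Fin n → ℂ) (y : Fin n) :
    torusLin n t v y = (t : ℂ) ^ (n - ((y : ℕ) + 1)) * v y := by
  change (t ^ (n - ((y : ℕ) + 1)) : ℂˣ) • v y = _
  rw [Units.smul_def, Units.val_pow_eq_pow_val, smul_eq_mul]

lemma IsNormalBasis.torus {I : Finset (Fin n)} {V : Gr d n} {b : Fin n → Fin n → ℂ}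
    (h : IsNormalBasis I V.1 b) (t : ℂˣ) :
    IsNormalBasis I (torusGr t V).1 (fun x y =>
      (t : ℂ) ^ (n - ((y : ℕ) + 1)) / (t : ℂ) ^ (n - ((x : ℕ) + 1)) * b x y) := by
  have ht : (t : ℂ) ≠ 0 := t.ne_zero
  refine ⟨?_, ?_, ?_⟩
  · intro x hx
    refine ⟨((t : ℂ) ^ (n - ((x : ℕ) + 1)))⁻¹ • b x, V.1.smul_mem _ (h.mem x hx), ?_⟩
    funext y
    simp only [LinearEquiv.coe_coe, torusLin_apply, Pi.smul_apply, smul_eq_mul]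
    ring
  · intro x hx y hy
    simp only [h.unit x hx y hy]
    split_ifs with hxy
    · subst hxy
      rw [div_self (pow_ne_zero _ ht), one_mul]
    · rw [mul_zero]
  · rintro _ ⟨v, hv, rfl⟩
    funext y
    simp only [LinearEquiv.coe_coe, torusLin_apply, Finset.sum_apply, Pi.smul_apply, smul_eq_mul]
    conv_lhs => rw [h.repr v hv]
    simp only [Finset.sum_apply, Pi.smul_apply, smul_eq_mul, Finset.mul_sum]
    refine Finset.sum_congr rfl fun x _ => ?_
    field_simp

lemma isNormalBasis_coordFrame (hd : d ≤ n) (u : Equiv.Perm (Fin n)) :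
    IsNormalBasis (pivots u d) (coordFrame hd u).span.1 (fun x => Pi.single x 1) := by
  have h : IsUnitBlock (pivots u d) (fun x => Pi.single x (1 : ℂ)) := by
    intro x _ y _
    simp [Pi.single_apply, eq_comm]
  have := h.isNormalBasis
  rwa [← span_normalFrame hd u _ h] at this

lemma isOpen_setOf_normalBasis_norm_lt_one (hd : d ≤ n) (u : Equiv.Perm (Fin n)) :
    IsOpen {V : Gr d n | ∃ b, IsNormalBasis (pivots u d) V.1 b ∧
      ∀ x ∈ pivots u d, ∀ y, y ∉ pivots u d → ‖b x y‖ < 1} := by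
  rw [isOpen_coinduced]
  have heq : Frame.span ⁻¹' {V : Gr d n | ∃ b, IsNormalBasis (pivots u d) V.1 b ∧
      ∀ x ∈ pivots u d, ∀ y, y ∉ pivots u d → ‖b x y‖ < 1} =
      {M : Frame d n | (M.minor hd u).det ≠ 0} ∩ ⋂ (r : Fin d), ⋂ (y : Fin n),
        {M | y ∉ pivots u d →
          ‖((M.minor hd u).adjugate * Matrix.of M.1) r y‖ < ‖(M.minor hd u).det‖} := by
    ext M
    have key : (M.minor hd u).det ≠ 0 → ∀ r y,
        (‖((M.minor hd u)⁻¹ * Matrix.of M.1) r y‖ < 1 ↔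
        ‖((M.minor hd u).adjugate * Matrix.of M.1) r y‖ < ‖(M.minor hd u).det‖) := by
      intro h0 r y
      rw [Matrix.inv_def, Matrix.smul_mul, Matrix.smul_apply, smul_eq_mul, Ring.inverse_eq_inv',
        norm_mul, norm_inv, inv_mul_lt_iff₀ (norm_pos_iff.2 h0), mul_one]
    simp only [Set.mem_preimage, Set.mem_ofPred_eq, Set.mem_inter_iff, Set.mem_iInter]
    constructor
    · rintro ⟨b, hb, hlt⟩
      have h0 := hb.det_minor_ne_zero hd
      refine ⟨h0, fun r y hy => ?_⟩
      rw [← key h0, hb.inv_minor_mul hd]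
      exact hlt _ (apply_castLE_mem_pivots hd u r) y hy
    · rintro ⟨h0, hlt⟩
      refine ⟨_, Frame.isNormalBasis_normalRows hd h0, fun x hx y hy => ?_⟩
      obtain ⟨r, rfl⟩ := exists_of_mem_pivots hd hx
      rw [Frame.normalRows_apply, key h0]
      exact hlt r y hy
  rw [heq]
  have hval : Continuous fun M : Frame d n => Matrix.of M.1 := continuous_subtype_val
  have hminor : Continuous fun M : Frame d n => M.minor hd u := by
    refine continuous_matrix fun r c => ?_
    exact hval.matrix_elem r _
  refine IsOpen.inter ?_ (isOpen_iInter_of_finite fun r => isOpen_iInter_of_finite fun y => ?_)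
  · exact isOpen_ne_fun hminor.matrix_det continuous_const
  · by_cases hy : y ∈ pivots u d
    · simp [hy]
    · simp only [hy, not_false_eq_true, true_imp_iff]
      exact isOpen_lt ((hminor.matrix_adjugate.matrix_mul hval).matrix_elem r y).norm
        hminor.matrix_det.norm

lemma neBot_comap_units_nhds_zero :
    (comap (fun t : ℂˣ => (t : ℂ)) (𝓝 0)).NeBot := by
  rw [comap_neBot_iff]
  intro s hs
  obtain ⟨t, ht, ht0⟩ := ((NormedField.nhdsNE_neBot (0 : ℂ)).nonempty_of_mem
    (inter_mem (mem_nhdsWithin_of_mem_nhds hs) self_mem_nhdsWithin))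
  exact ⟨Units.mk0 t ht0, ht⟩

/-- The attracting cell of a coordinate subspace: `t · V` tends to the coordinate subspace with
pivots `u(1), …, u(d)` exactly if `V` has a normalised basis in echelon form for these pivots. -/
theorem tendsto_torusGr_iff (hd : d ≤ n) (u : Equiv.Perm (Fin n)) (V : Gr d n) :
    Tendsto (fun t : ℂˣ => torusGr t V) (comap (fun t : ℂˣ => (t : ℂ)) (𝓝 0))
        (𝓝 (coordFrame hd u).span) ↔
      ∃ b, IsNormalBasis (pivots u d) V.1 b ∧ IsEchelon (pivots u d) b := by
  have := neBot_comap_units_nhds_zero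
  constructor
  · intro h
    have hmem := h.eventually_mem ((isOpen_setOf_normalBasis_norm_lt_one hd u).mem_nhds
      ⟨_, isNormalBasis_coordFrame hd u, fun x hx y hy => by
        have hne : y ≠ x := fun he => hy (he ▸ hx)
        simp [hne]⟩)
    -- the chart is stable under the torus, so `V` lies in it as well
    have hchart : ∃ b, IsNormalBasis (pivots u d) V.1 b := by
      obtain ⟨t, b, hb, -⟩ := hmem.exists
      have := hb.torus t⁻¹
      have hV : torusGr t⁻¹ (torusGr t V) = V := by
        apply Subtype.ext
        change (V.1.map _).map _ = V.1
        rw [← Submodule.map_comp]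
        convert Submodule.map_id V.1
        refine LinearMap.ext fun v => funext fun y => ?_
        simp [torusLin_apply]
      rw [hV] at this
      exact ⟨_, this⟩
    obtain ⟨b, hb⟩ := hchart
    refine ⟨b, hb, fun x hx y hxy => ?_⟩
    by_contra hne
    have hy : y ∉ pivots u d := fun hy => hne (by rw [hb.unit x hx y hy, if_neg hxy.ne])
    have hsmall : ∀ᶠ t : ℂˣ in comap (fun t : ℂˣ => (t : ℂ)) (𝓝 0),
        ‖(t : ℂ)‖ < min 1 ‖b x y‖ := by
      have : ∀ᶠ t : ℂ in 𝓝 0, ‖t‖ < min 1 ‖b x y‖ := by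
        refine (continuous_norm.tendsto' (0 : ℂ) 0 norm_zero).eventually_lt_const ?_
        exact lt_min one_pos (norm_pos_iff.2 hne)
      exact this.comap _
    obtain ⟨t, ⟨b', hb', hlt⟩, ht⟩ := (hmem.and hsmall).exists
    have h1 := hlt x hx y hy
    have hrow := congrFun ((hb.torus t).row_congr hb' hx) y
    rw [hrow] at h1
    have ht0 : 0 < ‖(t : ℂ)‖ := norm_pos_iff.2 t.ne_zero
    have hexp : n - ((x : ℕ) + 1) = (n - ((y : ℕ) + 1)) + ((y : ℕ) - x) := by
      have := y.2
      rw [Fin.lt_def] at hxy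
      omega
    rw [hexp, pow_add, norm_mul, norm_div, norm_mul, norm_pow, norm_pow, div_mul_cancel_left₀
      (pow_pos ht0 _).ne', inv_mul_lt_iff₀ (pow_pos ht0 _), mul_one] at h1
    have h2 : ‖(t : ℂ)‖ ^ ((y : ℕ) - x) ≤ ‖(t : ℂ)‖ := by
      apply pow_le_of_le_one ht0.le (ht.le.trans (min_le_left _ _))
      rw [Fin.lt_def] at hxy
      omega
    exact absurd (h1.trans_le h2) (not_lt.2 (ht.le.trans (min_le_right _ _)))
  · rintro ⟨b, hb, hech⟩
    -- the family `t ↦ t · V` extends to `t = 0` by rescaling the normalised rows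
    let bt : ℂ → Fin n → Fin n → ℂ := fun t x y => t ^ ((x : ℕ) - y) * b x y
    have hbt : ∀ t, IsUnitBlock (pivots u d) (bt t) := by
      intro t x hx y hy
      simp only [bt, hb.unit x hx y hy]
      split_ifs with hxy
      · simp [hxy]
      · simp
    let M : ℂ → Frame d n := fun t => normalFrame hd u (bt t) (hbt t)
    have hM : Continuous M := by
      refine Continuous.subtype_mk ?_ _
      refine continuous_pi fun r => continuous_pi fun y => ?_
      simp only [bt]
      fun_prop
    have hspan : Continuous (Frame.span : Frame d n → Gr d n) := continuous_coinduced_rng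
    have h0 : M 0 = coordFrame hd u := by
      apply Subtype.ext
      funext r y
      change (0 : ℂ) ^ (((u (Fin.castLE hd r) : Fin n) : ℕ) - y) * b (u (Fin.castLE hd r)) y =
        (Pi.single (u (Fin.castLE hd r)) (1 : ℂ) : Fin n → ℂ) y
      have hr := apply_castLE_mem_pivots hd u r
      generalize u (Fin.castLE hd r) = x at hr
      rcases lt_trichotomy x y with hxy | rfl | hxy
      · simp [hech x hr y hxy, hxy.ne']
      · simp [hb.unit x hr x hr]
      · have : (x : ℕ) - y ≠ 0 := by
          rw [Fin.lt_def] at hxy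
          omega
        simp [this, hxy.ne]
    have hlim : Tendsto (fun t : ℂˣ => (M t).span) (comap (fun t : ℂˣ => (t : ℂ)) (𝓝 0))
        (𝓝 (coordFrame hd u).span) := by
      rw [← h0]
      exact ((hspan.comp hM).tendsto 0).comp tendsto_comap
    refine hlim.congr fun t => ?_
    apply Subtype.ext
    rw [(hb.torus t).eq_rowSpan, span_normalFrame, rowSpan, rowSpan]
    congr 1
    refine Set.image_congr fun x hx => funext fun y => ?_
    rcases lt_or_ge x y with hxy | hxy
    · simp [bt, hech x hx y hxy]
    · have hexp : n - ((y : ℕ) + 1) = (n - ((x : ℕ) + 1)) + ((x : ℕ) - y) := by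
        have := x.2
        rw [Fin.le_def] at hxy
        omega
      rw [hexp, pow_add, mul_div_cancel_left₀ _ (pow_ne_zero _ t.ne_zero)]

end Limits

/-! ### One step of the tower -/

section Step

variable {n : ℕ}

/-- The normalised basis of the `d`-dimensional member of a flag, determined by the normalised
bases `a`, `b` of its members of dimensions `d - 1` and `d + 1`. The new member is spanned by the
smaller one and by the vector `b p + c • b q`, where `p` is its new pivot, `q` is the pivot
of the larger member that it misses, and `c` is the coordinate on the projective line of choices. -/
def newRows (a b : Fin n → Fin n → ℂ) (p q : Fin n) (c : ℂ) : Fin n → Fin n → ℂ :=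
  fun x => if x = p then b p + c • b q else a x - a x p • (b p + c • b q)

lemma newRows_self (a b : Fin n → Fin n → ℂ) (p q : Fin n) (c : ℂ) :
    newRows a b p q c p = b p + c • b q := if_pos rfl

lemma newRows_of_ne (a b : Fin n → Fin n → ℂ) {p x : Fin n} (q : Fin n) (c : ℂ) (h : x ≠ p) :
    newRows a b p q c x = a x - a x p • (b p + c • b q) := if_neg h

variable {J : Finset (Fin n)} {p q : Fin n} {a b : Fin n → Fin n → ℂ} {c : ℂ}

/-- The data of one step of the tower: subspaces of dimensions `d - 1` and `d + 1`, one contained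
in the other, with pivots `J` and `J ∪ {p, q}`. -/
structure IsStep (J : Finset (Fin n)) (p q : Fin n) (a b : Fin n → Fin n → ℂ) : Prop where
  p_notMem : p ∉ J
  q_notMem : q ∉ J
  ne : p ≠ q
  unit_left : IsUnitBlock J a
  echelon_left : IsEchelon J a
  unit_right : IsUnitBlock (insert q (insert p J)) b
  echelon_right : IsEchelon (insert q (insert p J)) b
  le : rowSpan J a ≤ rowSpan (insert q (insert p J)) b

namespace IsStep

lemma vec_p (h : IsStep J p q a b) : (b p + c • b q) p = 1 := by
  simp [h.unit_right p (by simp) p (by simp), h.unit_right q (by simp) p (by simp), h.ne.symm]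

lemma vec_q (h : IsStep J p q a b) : (b p + c • b q) q = c := by
  simp [h.unit_right p (by simp) q (by simp), h.unit_right q (by simp) q (by simp), h.ne]

lemma vec_of_mem (h : IsStep J p q a b) {y : Fin n} (hy : y ∈ J) : (b p + c • b q) y = 0 := by
  have hp : p ≠ y := fun he => h.p_notMem (he ▸ hy)
  have hq : q ≠ y := fun he => h.q_notMem (he ▸ hy)
  simp [h.unit_right p (by simp) y (by simp [hy]), h.unit_right q (by simp) y (by simp [hy]),
    hp, hq]

lemma vec_of_gt (h : IsStep J p q a b) (hc : p < q → c = 0) {y : Fin n} (hy : p < y) :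
    (b p + c • b q) y = 0 := by
  have h1 := h.echelon_right p (by simp) y hy
  rcases lt_or_gt_of_ne h.ne with hpq | hpq
  · simp [h1, hc hpq]
  · simp [h1, h.echelon_right q (by simp) y (hpq.trans hy)]

lemma ne_of_mem (h : IsStep J p q a b) {x : Fin n} (hx : x ∈ J) : x ≠ p :=
  fun he => h.p_notMem (he ▸ hx)

lemma unit_newRows (h : IsStep J p q a b) : IsUnitBlock (insert p J) (newRows a b p q c) := by
  intro x hx y hy
  rw [Finset.mem_insert] at hx hy
  rcases hx with rfl | hx
  · rw [newRows_self]
    rcases hy with rfl | hy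
    · rw [h.vec_p, if_pos rfl]
    · rw [h.vec_of_mem hy, if_neg (h.ne_of_mem hy).symm]
  · rw [newRows_of_ne _ _ _ _ (h.ne_of_mem hx), Pi.sub_apply, Pi.smul_apply]
    rcases hy with rfl | hy
    · rw [h.vec_p, if_neg (h.ne_of_mem hx), smul_eq_mul, mul_one, sub_self]
    · rw [h.vec_of_mem hy, smul_zero, sub_zero, h.unit_left x hx y hy]

lemma echelon_newRows (h : IsStep J p q a b) (hc : p < q → c = 0) :
    IsEchelon (insert p J) (newRows a b p q c) := by
  intro x hx y hxy
  rw [Finset.mem_insert] at hx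
  rcases hx with rfl | hx
  · rw [newRows_self, h.vec_of_gt hc hxy]
  · rw [newRows_of_ne _ _ _ _ (h.ne_of_mem hx), Pi.sub_apply, Pi.smul_apply,
      h.echelon_left x hx y hxy, smul_eq_mul, zero_sub, neg_eq_zero, mul_eq_zero]
    rcases lt_or_gt_of_ne (h.ne_of_mem hx) with hxp | hxp
    · exact Or.inl (h.echelon_left x hx p hxp)
    · exact Or.inr (h.vec_of_gt hc (hxp.trans hxy))

lemma left_le_newRows (h : IsStep J p q a b) :
    rowSpan J a ≤ rowSpan (insert p J) (newRows a b p q c) := by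
  refine rowSpan_le.2 fun x hx => ?_
  have h1 := row_mem_rowSpan (newRows a b p q c) (Finset.mem_insert_of_mem (a := x) (b := p) hx)
  have h2 := row_mem_rowSpan (newRows a b p q c) (Finset.mem_insert_self p J)
  rw [newRows_of_ne _ _ _ _ (h.ne_of_mem hx)] at h1
  rw [newRows_self] at h2
  simpa using Submodule.add_mem _ h1 (Submodule.smul_mem _ (a x p) h2)

lemma newRows_le_right (h : IsStep J p q a b) :
    rowSpan (insert p J) (newRows a b p q c) ≤ rowSpan (insert q (insert p J)) b := by
  have hv : b p + c • b q ∈ rowSpan (insert q (insert p J)) b :=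
    Submodule.add_mem _ (row_mem_rowSpan b (by simp))
      (Submodule.smul_mem _ _ (row_mem_rowSpan b (by simp)))
  refine rowSpan_le.2 fun x hx => ?_
  rw [Finset.mem_insert] at hx
  rcases hx with rfl | hx
  · rwa [newRows_self]
  · rw [newRows_of_ne _ _ _ _ (h.ne_of_mem hx)]
    exact Submodule.sub_mem _ (h.le (row_mem_rowSpan a hx)) (Submodule.smul_mem _ _ hv)

/-- Every subspace between the two given ones with the right pivots arises from `newRows`, its
coordinate being the entry `(p, q)` of its normalised basis. -/
lemma eq_newRows (h : IsStep J p q a b) {V : Submodule ℂ (Fin n → ℂ)} {b' : Fin n → Fin n → ℂ}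
    (hb' : IsNormalBasis (insert p J) V b') (h1 : rowSpan J a ≤ V)
    (h2 : V ≤ rowSpan (insert q (insert p J)) b) {x : Fin n} (hx : x ∈ insert p J) :
    b' x = newRows a b p q (b' p q) x := by
  have hp : p ∈ insert p J := Finset.mem_insert_self _ _
  have hv : b' p = b p + b' p q • b q := by
    have hr := h.unit_right.isNormalBasis.repr _ (h2 (hb'.mem p hp))
    rw [Finset.sum_insert (by simp [h.q_notMem, h.ne.symm]), Finset.sum_insert h.p_notMem,
      hb'.unit p hp p hp, if_pos rfl, one_smul, Finset.sum_eq_zero, add_zero, add_comm] at hr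
    · exact hr
    · intro y hy
      rw [hb'.unit p hp y (Finset.mem_insert_of_mem hy), if_neg (h.ne_of_mem hy).symm, zero_smul]
  symm
  refine hb'.eq_row hx ?_ (h.unit_newRows x hx)
  rw [Finset.mem_insert] at hx
  rcases hx with rfl | hx
  · rw [newRows_self, ← hv]
    exact hb'.mem _ hp
  · rw [newRows_of_ne _ _ _ _ (h.ne_of_mem hx), ← hv]
    exact V.sub_mem (h1 (row_mem_rowSpan a hx)) (V.smul_mem _ (hb'.mem p hp))

end IsStep

lemma pivots_succ_lo (u : Equiv.Perm (Fin n)) (i : Fin (n - 1)) :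
    pivots u ((i : ℕ) + 1) = insert (u (lo i)) (pivots u i) := by
  ext x
  simp only [mem_pivots, Finset.mem_insert, ← Equiv.symm_apply_eq, lo, Fin.ext_iff]
  omega

lemma pivots_succ_hi (u : Equiv.Perm (Fin n)) (i : Fin (n - 1)) :
    pivots u ((i : ℕ) + 1 + 1) = insert (u (hi i)) (pivots u ((i : ℕ) + 1)) := by
  ext x
  simp only [mem_pivots, Finset.mem_insert, ← Equiv.symm_apply_eq, hi, Fin.ext_iff]
  omega

lemma pivots_mul_simple (u : Equiv.Perm (Fin n)) (i : Fin (n - 1)) {k : ℕ}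
    (hk : k ≠ (i : ℕ) + 1) : pivots (u * simple i) k = pivots u k := by
  ext x
  have : (u * simple i).symm x = simple i (u.symm x) := by
    rw [Equiv.symm_apply_eq, Equiv.Perm.mul_apply, simple_simple, Equiv.apply_symm_apply]
  rw [mem_pivots, mem_pivots, this, simple, Equiv.swap_apply_def]
  split_ifs with h1 h2
  · rw [h1]; dsimp only; omega
  · rw [h2]; dsimp only; omega
  · rfl

end Step

/-! ### The flags of a point of the Bott–Samelson variety -/

section Flag

variable {n l : ℕ} (w : Fin l → Fin (n - 1))

/-- The flag reached after `m` steps: in dimension `i` it consists of the last `V_k` of dimension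
`i` among the first `m`, or of the standard subspace if there is none. -/
def flag (V : GrProd (colDim w) n) (m : Fin (l + 1)) : ℕ → Submodule ℂ (Fin n → ℂ) :=
  Fin.induction (motive := fun _ => ℕ → Submodule ℂ (Fin n → ℂ)) (stdSubspace n)
    (fun j F => Function.update F (colDim w j) (V j).1) m

lemma flag_zero (V : GrProd (colDim w) n) : flag w V 0 = stdSubspace n := rfl

lemma flag_succ (V : GrProd (colDim w) n) (j : Fin l) :
    flag w V j.succ = Function.update (flag w V j.castSucc) (colDim w j) (V j).1 :=
  Fin.induction_succ _ _ _

lemma flag_eq (V : GrProd (colDim w) n) (m : Fin (l + 1)) (i : ℕ) :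
    (∀ k, IsGreatest {k : Fin l | k.castSucc < m ∧ colDim w k = i} k → flag w V m i = (V k).1) ∧
    ({k : Fin l | k.castSucc < m ∧ colDim w k = i} = ∅ → flag w V m i = stdSubspace n i) := by
  induction m using Fin.induction with
  | zero => exact ⟨fun k hk => absurd hk.1.1 (Fin.not_lt_zero _), fun _ => rfl⟩
  | succ j ih =>
    by_cases hj : colDim w j = i
    · subst hj
      rw [flag_succ, Function.update_self]
      have hmem : j ∈ {k : Fin l | k.castSucc < j.succ ∧ colDim w k = colDim w j} :=
        ⟨Fin.castSucc_lt_succ, rfl⟩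
      refine ⟨fun k hk => ?_, fun h => ?_⟩
      · have h1 : j ≤ k := hk.2 hmem
        have h2 : k ≤ j := Fin.castSucc_lt_succ_iff.1 hk.1.1
        rw [le_antisymm h2 h1]
      · rw [h] at hmem
        exact absurd hmem (Set.notMem_empty _)
    · rw [flag_succ, Function.update_of_ne (Ne.symm hj)]
      have hset : {k : Fin l | k.castSucc < j.succ ∧ colDim w k = i} =
          {k : Fin l | k.castSucc < j.castSucc ∧ colDim w k = i} := by
        ext k
        simp only [Set.mem_ofPred_eq, Fin.castSucc_lt_succ_iff, Fin.castSucc_lt_castSucc_iff]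
        refine and_congr_left fun hk => ⟨fun h => lt_of_le_of_ne h ?_, le_of_lt⟩
        rintro rfl
        exact hj hk
      rw [hset]
      exact ih

/-- The conditions defining the variety say that every `V_j` refines the flag before it. -/
lemma mem_variety_iff (V : GrProd (colDim w) n) :
    V ∈ variety w ↔ ∀ j : Fin l, flag w V j.castSucc (colDim w j - 1) ≤ (V j).1 ∧
      (V j).1 ≤ flag w V j.castSucc (colDim w j + 1) := by
  refine forall_congr' fun j => ?_
  have hl : leftBefore w j =
      {k : Fin l | k.castSucc < j.castSucc ∧ colDim w k = colDim w j - 1} := by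
    ext k
    simp only [leftBefore, Set.mem_ofPred_eq, Fin.castSucc_lt_castSucc_iff]
    refine and_congr_right fun _ => ?_
    simp only [colDim]
    omega
  have hr : rightBefore w j =
      {k : Fin l | k.castSucc < j.castSucc ∧ colDim w k = colDim w j + 1} := by
    ext k
    simp only [rightBefore, Set.mem_ofPred_eq, Fin.castSucc_lt_castSucc_iff]
  have hgreatest : ∀ S : Set (Fin l), S = ∅ ∨ ∃ k, IsGreatest S k := by
    intro S
    rcases S.eq_empty_or_nonempty with h | h
    · exact Or.inl h
    · obtain ⟨k, hk, hmax⟩ := S.toFinite.exists_maximal h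
      exact Or.inr ⟨k, hk, fun x hx => (le_total x k).elim id fun h => hmax hx h⟩
  have hL := flag_eq w V j.castSucc (colDim w j - 1)
  have hR := flag_eq w V j.castSucc (colDim w j + 1)
  rw [← hl] at hL
  rw [← hr] at hR
  constructor
  · rintro ⟨h1, h2, h3, h4⟩
    constructor
    · rcases hgreatest (leftBefore w j) with h | ⟨k, hk⟩
      · rw [hL.2 h]; exact h2 h
      · rw [hL.1 k hk]; exact h1 k hk
    · rcases hgreatest (rightBefore w j) with h | ⟨k, hk⟩
      · rw [hR.2 h]; exact h4 h
      · rw [hR.1 k hk]; exact h3 k hk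
  · rintro ⟨h1, h2⟩
    exact ⟨fun k hk => hL.1 k hk ▸ h1, fun h => hL.2 h ▸ h1, fun k hk => hR.1 k hk ▸ h2,
      fun h => hR.2 h ▸ h2⟩

end Flag

/-! ### The parametrisation of the cell -/

section Parametrisation

open Topology Filter

variable {n l : ℕ} (w : Fin l → Fin (n - 1)) (σ : Mask l)

/-- The pivot of `V_j` that is not one of the `(d_j - 1)`-dimensional member of its flag. -/
def newPivot (j : Fin l) : Fin n := initialProd w σ j.succ (lo (w j))

/-- The pivot of the `(d_j + 1)`-dimensional member of the flag that `V_j` misses. -/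
def missedPivot (j : Fin l) : Fin n := initialProd w σ j.succ (hi (w j))

lemma isFree_iff_missedPivot_lt (j : Fin l) :
    IsFree w σ j ↔ missedPivot w σ j < newPivot w σ j := Iff.rfl

open Classical in
/-- The coordinate used in step `j`, which is zero unless `j` is free. -/
def coeff (c : {j // IsFree w σ j} → ℂ) (j : Fin l) : ℂ :=
  if h : IsFree w σ j then c ⟨j, h⟩ else 0

/-- The normalised bases of all members of the flag after `m` steps, given the coordinates, indexed
by dimension. Since letters are zero-based, `d_j - 1` is `w j` and `d_j + 1` is `w j + 1 + 1`. -/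
def rows (c : {j // IsFree w σ j} → ℂ) (m : Fin (l + 1)) : ℕ → Fin n → Fin n → ℂ :=
  Fin.induction (motive := fun _ => ℕ → Fin n → Fin n → ℂ) (fun _ x => Pi.single x 1)
    (fun j B => Function.update B (colDim w j)
      (newRows (B (w j)) (B (w j + 1 + 1)) (newPivot w σ j) (missedPivot w σ j) (coeff w σ c j))) m

variable (c : {j // IsFree w σ j} → ℂ)

lemma rows_zero : rows w σ c 0 = fun _ x => Pi.single x 1 := rfl

lemma rows_succ (j : Fin l) :
    rows w σ c j.succ = Function.update (rows w σ c j.castSucc) (colDim w j)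
      (newRows (rows w σ c j.castSucc (w j)) (rows w σ c j.castSucc (w j + 1 + 1))
        (newPivot w σ j) (missedPivot w σ j) (coeff w σ c j)) :=
  Fin.induction_succ _ _ _

lemma rows_succ_self (j : Fin l) :
    rows w σ c j.succ (colDim w j) =
      newRows (rows w σ c j.castSucc (w j)) (rows w σ c j.castSucc (w j + 1 + 1))
        (newPivot w σ j) (missedPivot w σ j) (coeff w σ c j) := by
  rw [rows_succ, Function.update_self]

lemma coeff_eq_zero (j : Fin l) (h : newPivot w σ j < missedPivot w σ j) :
    coeff w σ c j = 0 :=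
  dif_neg fun hf => lt_asymm h ((isFree_iff_missedPivot_lt w σ j).1 hf)

lemma pivots_initialProd_succ (j : Fin l) {k : ℕ} (hk : k ≠ colDim w j) :
    pivots (initialProd w σ j.succ) k = pivots (initialProd w σ j.castSucc) k := by
  rw [initialProd_succ, maskedLetter]
  split_ifs
  · exact pivots_mul_simple _ _ hk
  · rw [mul_one]

lemma pivots_succ_colDim (j : Fin l) :
    pivots (initialProd w σ j.succ) (colDim w j) =
      insert (newPivot w σ j) (pivots (initialProd w σ j.castSucc) (w j)) := by
  rw [← pivots_initialProd_succ w σ j (k := w j) (by simp [colDim])]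
  exact pivots_succ_lo _ _

lemma pivots_castSucc_colDim_succ (j : Fin l) :
    pivots (initialProd w σ j.castSucc) (w j + 1 + 1) =
      insert (missedPivot w σ j) (insert (newPivot w σ j)
        (pivots (initialProd w σ j.castSucc) (w j))) := by
  rw [← pivots_initialProd_succ w σ j (k := w j + 1 + 1) (by simp [colDim]),
    ← pivots_succ_colDim]
  exact pivots_succ_hi _ _

/-- The rows `B i` are normalised echelon bases, with pivots given by `u`, of the members of a
flag. -/
structure IsEchelonFlag (u : Equiv.Perm (Fin n)) (B : ℕ → Fin n → Fin n → ℂ) : Prop where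
  unit : ∀ i, IsUnitBlock (pivots u i) (B i)
  echelon : ∀ i, IsEchelon (pivots u i) (B i)
  mono : ∀ i, rowSpan (pivots u i) (B i) ≤ rowSpan (pivots u (i + 1)) (B (i + 1))

lemma IsEchelonFlag.isStep {j : Fin l} {B : ℕ → Fin n → Fin n → ℂ}
    (h : IsEchelonFlag (initialProd w σ j.castSucc) B) :
    IsStep (pivots (initialProd w σ j.castSucc) (w j)) (newPivot w σ j) (missedPivot w σ j)
      (B (w j)) (B (w j + 1 + 1)) where
  p_notMem := by
    rw [← pivots_initialProd_succ w σ j (k := w j) (by simp [colDim]), mem_pivots, newPivot,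
      Equiv.symm_apply_apply]
    simp [lo]
  q_notMem := by
    rw [← pivots_initialProd_succ w σ j (k := w j) (by simp [colDim]), mem_pivots, missedPivot,
      Equiv.symm_apply_apply]
    simp [hi]
  ne := fun he => (lo_lt_hi (w j)).ne ((initialProd w σ j.succ).injective he)
  unit_left := h.unit _
  echelon_left := h.echelon _
  unit_right := by
    rw [← pivots_castSucc_colDim_succ]
    exact h.unit _
  echelon_right := by
    rw [← pivots_castSucc_colDim_succ]
    exact h.echelon _
  le := by
    rw [← pivots_castSucc_colDim_succ]
    exact (h.mono _).trans (h.mono _)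

lemma isEchelonFlag_rows (m : Fin (l + 1)) :
    IsEchelonFlag (initialProd w σ m) (rows w σ c m) := by
  induction m using Fin.induction with
  | zero =>
    refine ⟨fun i x _ y _ => ?_, fun i x _ y hxy => ?_, fun i => rowSpan_le.2 fun x hx => ?_⟩
    · simp [rows_zero, Pi.single_apply, eq_comm]
    · simp [rows_zero, hxy.ne']
    · rw [rows_zero]
      refine row_mem_rowSpan (fun x => Pi.single x 1) (mem_pivots.2 ?_)
      have := mem_pivots.1 hx
      omega
  | succ j ih =>
    have hs := ih.isStep
    refine ⟨fun i => ?_, fun i => ?_, fun i => ?_⟩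
    · by_cases hi : i = colDim w j
      · subst hi
        rw [rows_succ_self, pivots_succ_colDim]
        exact hs.unit_newRows
      · rw [rows_succ, Function.update_of_ne hi, pivots_initialProd_succ w σ j hi]
        exact ih.unit i
    · by_cases hi : i = colDim w j
      · subst hi
        rw [rows_succ_self, pivots_succ_colDim]
        exact hs.echelon_newRows (coeff_eq_zero w σ c j)
      · rw [rows_succ, Function.update_of_ne hi, pivots_initialProd_succ w σ j hi]
        exact ih.echelon i
    · by_cases hi : i = colDim w j
      · subst hi
        rw [rows_succ_self, pivots_succ_colDim, rows_succ, Function.update_of_ne (by omega),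
          pivots_initialProd_succ w σ j (by omega)]
        refine hs.newRows_le_right.trans (le_of_eq ?_)
        rw [← pivots_castSucc_colDim_succ]
        rfl
      · rw [rows_succ, Function.update_of_ne hi, pivots_initialProd_succ w σ j hi]
        by_cases hi' : i + 1 = colDim w j
        · have hiw : i = w j := by simpa [colDim] using hi'
          rw [hi', Function.update_self, pivots_succ_colDim, hiw]
          exact hs.left_le_newRows
        · rw [Function.update_of_ne hi', pivots_initialProd_succ w σ j hi']
          exact ih.mono i

/-- The point of the cell with coordinates `c`. -/
def param : GrProd (colDim w) n := fun j =>
  (normalFrame (colDim_le w j) (initialProd w σ j.succ) (rows w σ c j.succ (colDim w j))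
    ((isEchelonFlag_rows w σ c j.succ).unit _)).span

lemma param_val (j : Fin l) : (param w σ c j).1 =
    rowSpan (pivots (initialProd w σ j.succ) (colDim w j)) (rows w σ c j.succ (colDim w j)) :=
  span_normalFrame _ _ _ _

lemma isNormalBasis_param (j : Fin l) :
    IsNormalBasis (pivots (initialProd w σ j.succ) (colDim w j)) (param w σ c j).1
      (rows w σ c j.succ (colDim w j)) := by
  rw [param_val]
  exact ((isEchelonFlag_rows w σ c j.succ).unit _).isNormalBasis

lemma stdSubspace_eq_rowSpan (i : ℕ) :
    stdSubspace n i = rowSpan (pivots (1 : Equiv.Perm (Fin n)) i) (fun x => Pi.single x 1) := by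
  rw [stdSubspace, rowSpan]
  congr 1
  ext v
  constructor
  · rintro ⟨k, hk, rfl⟩
    exact ⟨k, mem_pivots.2 hk, rfl⟩
  · rintro ⟨k, hk, rfl⟩
    exact ⟨k, mem_pivots.1 hk, rfl⟩

/-- If `V` agrees with the point with coordinates `c`, step by step, then its flags are the ones
spanned by the rows. -/
lemma flag_eq_rowSpan {V : GrProd (colDim w) n} (m : Fin (l + 1))
    (h : ∀ j : Fin l, j.castSucc < m → V j = param w σ c j) (i : ℕ) :
    flag w V m i = rowSpan (pivots (initialProd w σ m) i) (rows w σ c m i) := by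
  induction m using Fin.induction with
  | zero =>
    rw [flag_zero, rows_zero, initialProd_zero]
    exact stdSubspace_eq_rowSpan i
  | succ j ih =>
    rw [flag_succ]
    by_cases hi : i = colDim w j
    · subst hi
      rw [Function.update_self, h j Fin.castSucc_lt_succ, param_val]
    · rw [Function.update_of_ne hi, rows_succ, Function.update_of_ne hi,
        pivots_initialProd_succ w σ j hi]
      exact ih fun k hk => h k (hk.trans Fin.castSucc_lt_succ)

lemma mem_cell_iff (V : GrProd (colDim w) n) :
    V ∈ cell w σ ↔ V ∈ variety w ∧ ∀ j, ∃ b,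
      IsNormalBasis (pivots (initialProd w σ j.succ) (colDim w j)) (V j).1 b ∧
        IsEchelon (pivots (initialProd w σ j.succ) (colDim w j)) b := by
  rw [cell, Set.mem_ofPred_eq, tendsto_pi_nhds]
  exact and_congr_right fun _ => forall_congr' fun j => tendsto_torusGr_iff _ _ _

lemma param_mem_cell : param w σ c ∈ cell w σ := by
  rw [mem_cell_iff]
  refine ⟨(mem_variety_iff w _).2 fun j => ?_, fun j => ⟨_, isNormalBasis_param w σ c j,
    (isEchelonFlag_rows w σ c j.succ).echelon _⟩⟩
  have hs := (isEchelonFlag_rows w σ c j.castSucc).isStep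
  rw [flag_eq_rowSpan w σ c _ (fun _ _ => rfl), flag_eq_rowSpan w σ c _ (fun _ _ => rfl),
    param_val, rows_succ_self, pivots_succ_colDim]
  exact ⟨hs.left_le_newRows, hs.newRows_le_right.trans
    (le_of_eq (by rw [← pivots_castSucc_colDim_succ]; rfl))⟩

lemma newPivot_mem (j : Fin l) :
    newPivot w σ j ∈ pivots (initialProd w σ j.succ) (colDim w j) := by
  rw [pivots_succ_colDim]
  exact Finset.mem_insert_self _ _

lemma exists_param_eq {V : GrProd (colDim w) n} (hV : V ∈ cell w σ) :
    ∃ c, param w σ c = V := by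
  rw [mem_cell_iff, mem_variety_iff] at hV
  obtain ⟨hvar, hb⟩ := hV
  choose b hb hech using hb
  let c : {j // IsFree w σ j} → ℂ := fun j => b j.1 (newPivot w σ j.1) (missedPivot w σ j.1)
  have hcoeff : ∀ j, coeff w σ c j = b j (newPivot w σ j) (missedPivot w σ j) := by
    intro j
    rw [coeff]
    split_ifs with h
    · rfl
    · refine (hech j _ (newPivot_mem w σ j) _ (lt_of_le_of_ne (not_lt.1 h) ?_)).symm
      exact (isEchelonFlag_rows w σ c j.castSucc).isStep.ne
  refine ⟨c, ?_⟩
  suffices h : ∀ (m : Fin (l + 1)) (j : Fin l), j.castSucc < m → V j = param w σ c j from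
    funext fun j => (h (Fin.last l) j (Fin.castSucc_lt_last j)).symm
  intro m
  induction m using Fin.induction with
  | zero => exact fun j hj => absurd hj (Fin.not_lt_zero _)
  | succ j ih =>
    intro k hk
    rcases (Fin.castSucc_lt_succ_iff.1 hk).lt_or_eq with hk | rfl
    · exact ih k (Fin.castSucc_lt_castSucc_iff.2 hk)
    · have hs := (isEchelonFlag_rows w σ c k.castSucc).isStep
      have hv := hvar k
      rw [flag_eq_rowSpan w σ c _ ih, flag_eq_rowSpan w σ c _ ih] at hv
      have hbk := hb k
      rw [pivots_succ_colDim] at hbk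
      apply Subtype.ext
      rw [param_val, hbk.eq_rowSpan, rows_succ_self, pivots_succ_colDim, rowSpan, rowSpan]
      congr 1
      refine Set.image_congr fun x hx => ?_
      rw [hcoeff]
      refine hs.eq_newRows hbk hv.1 (hv.2.trans (le_of_eq ?_)) hx
      rw [← pivots_castSucc_colDim_succ]
      rfl

theorem range_param : Set.range (param w σ) = cell w σ :=
  subset_antisymm (Set.range_subset_iff.2 (param_mem_cell w σ)) fun _ hV => exists_param_eq w σ hV

/-- The coordinates of a point of the cell are entries of its normalised bases. -/
lemma rows_newPivot_missedPivot (j : {j // IsFree w σ j}) :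
    rows w σ c j.1.succ (colDim w j.1) (newPivot w σ j.1) (missedPivot w σ j.1) = c j := by
  rw [rows_succ_self, newRows_self, (isEchelonFlag_rows w σ c j.1.castSucc).isStep.vec_q, coeff,
    dif_pos j.2]

end Parametrisation

/-! ### Polynomial dependence -/

section Polynomial

open Topology MvPolynomial

/-- A function on affine space is polynomial. -/
def IsPolynomial {ι : Type} (f : (ι → ℂ) → ℂ) : Prop :=
  ∃ p : MvPolynomial ι ℂ, ∀ x, eval x p = f x

namespace IsPolynomial

variable {ι : Type} {f g : (ι → ℂ) → ℂ}

lemma const (a : ℂ) : IsPolynomial fun _ : ι → ℂ => a := ⟨C a, fun _ => eval_C _⟩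

lemma coord (i : ι) : IsPolynomial fun x : ι → ℂ => x i := ⟨X i, fun _ => eval_X _⟩

lemma add (hf : IsPolynomial f) (hg : IsPolynomial g) : IsPolynomial fun x => f x + g x := by
  obtain ⟨p, hp⟩ := hf
  obtain ⟨q, hq⟩ := hg
  exact ⟨p + q, fun x => by rw [map_add, hp, hq]⟩

lemma mul (hf : IsPolynomial f) (hg : IsPolynomial g) : IsPolynomial fun x => f x * g x := by
  obtain ⟨p, hp⟩ := hf
  obtain ⟨q, hq⟩ := hg
  exact ⟨p * q, fun x => by rw [map_mul, hp, hq]⟩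

lemma sub (hf : IsPolynomial f) (hg : IsPolynomial g) : IsPolynomial fun x => f x - g x := by
  obtain ⟨p, hp⟩ := hf
  obtain ⟨q, hq⟩ := hg
  exact ⟨p - q, fun x => by rw [map_sub, hp, hq]⟩

end IsPolynomial

lemma continuous_zariskiAffine {ι κ : Type} {φ : (ι → ℂ) → κ → ℂ}
    (h : ∀ k, IsPolynomial fun x => φ x k) :
    Continuous[zariskiAffine ι, zariskiAffine κ] φ := by
  choose p hp using h
  let _ := zariskiAffine ι
  let _ := zariskiAffine κ
  refine continuous_iff_isClosed.2 fun A hA => ?_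
  obtain ⟨I, rfl⟩ := (isClosed_zariskiAffine_iff _).1 hA
  refine (isClosed_zariskiAffine_iff _).2 ⟨(fun f => bind₁ p f) '' I, ?_⟩
  ext x
  have hx : (fun k => eval x (p k)) = φ x := funext fun k => hp k x
  simp only [Set.mem_preimage, Set.mem_ofPred_eq, Set.forall_mem_image]
  refine forall₂_congr fun f _ => ?_
  rw [← hx, ← coe_aeval_eq_eval x, ← aeval_eq_eval, RingHom.coe_coe, aeval_bind₁]

variable {n l : ℕ} (w : Fin l → Fin (n - 1)) (σ : Mask l)

lemma isPolynomial_newRows {ι : Type} {a b : (ι → ℂ) → Fin n → Fin n → ℂ} {c : (ι → ℂ) → ℂ}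
    (ha : ∀ x y, IsPolynomial fun t => a t x y) (hb : ∀ x y, IsPolynomial fun t => b t x y)
    (hc : IsPolynomial c) (p q x y : Fin n) :
    IsPolynomial fun t => newRows (a t) (b t) p q (c t) x y := by
  have hv : IsPolynomial fun t => b t p y + c t * b t q y := (hb p y).add (hc.mul (hb q y))
  by_cases hx : x = p
  · simpa [newRows, hx] using hv
  · simpa [newRows, hx, mul_add] using (ha x y).sub ((ha x p).mul hv)

lemma isPolynomial_rows (m : Fin (l + 1)) (i : ℕ) (x y : Fin n) :
    IsPolynomial fun c => rows w σ c m i x y := by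
  induction m using Fin.induction generalizing i x y with
  | zero => exact IsPolynomial.const _
  | succ j ih =>
    simp only [rows_succ]
    by_cases hi : i = colDim w j
    · subst hi
      simp only [Function.update_self]
      refine isPolynomial_newRows (ih _) (ih _) ?_ _ _ _ _
      by_cases hj : IsFree w σ j
      · simpa only [coeff, hj, dif_pos] using IsPolynomial.coord (⟨j, hj⟩ : {j // IsFree w σ j})
      · simpa only [coeff, hj, dif_neg, not_false_eq_true] using IsPolynomial.const 0
    · simp only [Function.update_of_ne hi]
      exact ih _ _ _

lemma continuous_param :
    Continuous[zariskiAffine {j // IsFree w σ j}, zariskiGrProd (colDim w) n] (param w σ) := by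
  let frames : ({j // IsFree w σ j} → ℂ) → (j : Fin l) → Frame (colDim w j) n := fun c j =>
    normalFrame (colDim_le w j) (initialProd w σ j.succ) (rows w σ c j.succ (colDim w j))
      ((isEchelonFlag_rows w σ c j.succ).unit _)
  have hframes : Continuous[zariskiAffine {j // IsFree w σ j},
      TopologicalSpace.induced (frameCoords (colDim w) n) (zariskiAffine _)] frames := by
    rw [continuous_induced_rng]
    exact continuous_zariskiAffine fun k => isPolynomial_rows w σ k.1.succ (colDim w k.1)
      (initialProd w σ k.1.succ (Fin.castLE (colDim_le w k.1) k.2.1)) k.2.2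
  exact @Continuous.comp _ _ _ (zariskiAffine _)
    (TopologicalSpace.induced (frameCoords (colDim w) n) (zariskiAffine _))
    (zariskiGrProd (colDim w) n) _ _ continuous_coinduced_rng hframes

end Polynomial

/-! ### Coordinates of the cell as regular functions -/

section Coordinates

open Topology MvPolynomial

variable {n l : ℕ} {d : Fin l → ℕ} (hd : ∀ j, d j ≤ n) (u : Fin l → Equiv.Perm (Fin n))

/-- The pivot block of the `j`-th frame, with indeterminate entries. -/
def genericMinor (j : Fin l) :
    Matrix (Fin (d j)) (Fin (d j)) (MvPolynomial ((j : Fin l) × (Fin (d j) × Fin n)) ℂ) :=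
  Matrix.of fun r c => X ⟨j, (r, u j (Fin.castLE (hd j) c))⟩

/-- The polynomial giving the determinant of the pivot block of the `j`-th frame. -/
def detPoly (j : Fin l) : MvPolynomial ((j : Fin l) × (Fin (d j) × Fin n)) ℂ :=
  (genericMinor hd u j).det

/-- The polynomial giving an entry of the `j`-th normalised frame, times the determinant of its
pivot block. -/
def entryPoly (j : Fin l) (r : Fin (d j)) (y : Fin n) :
    MvPolynomial ((j : Fin l) × (Fin (d j) × Fin n)) ℂ :=
  ((genericMinor hd u j).adjugate *
    Matrix.of fun (r : Fin (d j)) (y : Fin n) =>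
      (X ⟨j, (r, y)⟩ : MvPolynomial ((j : Fin l) × (Fin (d j) × Fin n)) ℂ)) r y

variable (M : (j : Fin l) → Frame (d j) n)

lemma map_genericMinor (j : Fin l) :
    (genericMinor hd u j).map (eval (frameCoords d n M)) = (M j).minor (hd j) (u j) := by
  ext r c
  simp [frameCoords, Frame.minor, genericMinor]

lemma eval_detPoly (j : Fin l) :
    eval (frameCoords d n M) (detPoly hd u j) = ((M j).minor (hd j) (u j)).det := by
  rw [detPoly, RingHom.map_det, RingHom.mapMatrix_apply, map_genericMinor]

lemma eval_entryPoly (j : Fin l) (r : Fin (d j)) (y : Fin n)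
    (h : ((M j).minor (hd j) (u j)).det ≠ 0) :
    eval (frameCoords d n M) (entryPoly hd u j r y) =
      ((M j).minor (hd j) (u j)).det *
        (M j).normalRows (hd j) (u j) (u j (Fin.castLE (hd j) r)) y := by
  have h2 := RingHom.map_adjugate (eval (frameCoords d n M)) (genericMinor hd u j)
  rw [RingHom.mapMatrix_apply, RingHom.mapMatrix_apply, map_genericMinor] at h2
  have h3 : eval (frameCoords d n M) (entryPoly hd u j r y) =
      (((M j).minor (hd j) (u j)).adjugate * Matrix.of (M j).1) r y := by
    rw [← h2, entryPoly, Matrix.mul_apply, Matrix.mul_apply, map_sum]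
    refine Finset.sum_congr rfl fun s _ => ?_
    rw [map_mul]
    simp [frameCoords]
  rw [h3, Frame.normalRows_apply, Matrix.inv_def, Matrix.smul_mul, Matrix.smul_apply, smul_eq_mul,
    Ring.inverse_eq_inv', mul_inv_cancel_left₀ h]

/-- Polynomials in the entries of normalised bases become polynomials in the entries of arbitrary
frames after multiplication by a power of the pivot determinants. -/
lemma exists_clear_denominators {ι : Type} (pos : ι → (j : Fin l) × (Fin (d j) × Fin n))
    (f : MvPolynomial ι ℂ) :
    ∃ (k : ℕ) (G : MvPolynomial ((j : Fin l) × (Fin (d j) × Fin n)) ℂ),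
      ∀ M : (j : Fin l) → Frame (d j) n, (∀ j, ((M j).minor (hd j) (u j)).det ≠ 0) →
        eval (frameCoords d n M) G = (∏ j, ((M j).minor (hd j) (u j)).det) ^ k *
          eval (fun i => (M (pos i).1).normalRows (hd (pos i).1) (u (pos i).1)
            (u (pos i).1 (Fin.castLE (hd (pos i).1) (pos i).2.1)) (pos i).2.2) f := by
  induction f using MvPolynomial.induction_on with
  | C a => exact ⟨0, C a, fun M _ => by simp⟩
  | add f g hf hg =>
    obtain ⟨k, F, hF⟩ := hf
    obtain ⟨k', G, hG⟩ := hg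
    refine ⟨k + k', (∏ j, detPoly hd u j) ^ k' * F + (∏ j, detPoly hd u j) ^ k * G,
      fun M hM => ?_⟩
    simp only [map_add, map_mul, map_pow, map_prod, eval_detPoly, hF M hM, hG M hM]
    ring
  | mul_X f i hf =>
    obtain ⟨k, F, hF⟩ := hf
    refine ⟨k + 1, F * (entryPoly hd u (pos i).1 (pos i).2.1 (pos i).2.2 *
      ∏ j ∈ Finset.univ.erase (pos i).1, detPoly hd u j), fun M hM => ?_⟩
    simp only [map_mul, map_prod, eval_detPoly, hF M hM, eval_entryPoly hd u M _ _ _ (hM _),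
      eval_X, pow_succ]
    rw [← Finset.mul_prod_erase Finset.univ _ (Finset.mem_univ (pos i).1)]
    ring

/-- The Zariski closed set obtained from a polynomial equation between entries of normalised
bases, together with the complement of the chart. -/
lemma isClosed_setOf_normalBasis_eval_eq_zero {ι : Type}
    (pos : ι → (j : Fin l) × (Fin (d j) × Fin n)) (f : MvPolynomial ι ℂ) :
    IsClosed[zariskiGrProd d n] {V : GrProd d n | ∀ b : Fin l → Fin n → Fin n → ℂ,
      (∀ j, IsNormalBasis (pivots (u j) (d j)) (V j).1 (b j)) →
        eval (fun i => b (pos i).1 (u (pos i).1 (Fin.castLE (hd (pos i).1) (pos i).2.1))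
          (pos i).2.2) f = 0} := by
  rw [isClosed_coinduced]
  obtain ⟨k, G, hG⟩ := exists_clear_denominators hd u pos f
  rw [@isClosed_induced_iff _ _ (zariskiAffine _)]
  refine ⟨{x | eval x ((∏ j, detPoly hd u j) * G) = 0},
    (isClosed_zariskiAffine_iff _).2 ⟨{(∏ j, detPoly hd u j) * G}, by simp⟩, ?_⟩
  ext M
  simp only [Set.mem_preimage, Set.mem_ofPred_eq, map_mul, map_prod, eval_detPoly, mul_eq_zero]
  constructor
  · rintro h b hb
    have hdet : ∀ j, ((M j).minor (hd j) (u j)).det ≠ 0 := fun j =>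
      (hb j).det_minor_ne_zero (hd j)
    have hprod : ∏ j, ((M j).minor (hd j) (u j)).det ≠ 0 :=
      Finset.prod_ne_zero_iff.2 fun j _ => hdet j
    have h1 := h.resolve_left hprod
    rw [hG M hdet, mul_eq_zero] at h1
    rw [← h1.resolve_left (pow_ne_zero _ hprod)]
    congr 2
    funext i
    exact congrFun ((Frame.isNormalBasis_normalRows (hd _) (hdet _)).row_congr (hb _)
      (apply_castLE_mem_pivots _ _ _)) _
  · intro h
    by_cases hdet : ∀ j, ((M j).minor (hd j) (u j)).det ≠ 0
    · right
      rw [hG M hdet, h (fun j => (M j).normalRows (hd j) (u j)) fun j =>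
        Frame.isNormalBasis_normalRows (hd j) (hdet j), mul_zero]
    · left
      push Not at hdet
      obtain ⟨j, hj⟩ := hdet
      exact Finset.prod_eq_zero (Finset.mem_univ j) hj

end Coordinates

/-! ### The dimension of the cell -/

section Dimension

open Topology MvPolynomial

variable {n l : ℕ} (w : Fin l → Fin (n - 1)) (σ : Mask l)

lemma param_injective : Function.Injective (param w σ) := by
  intro c c' h
  funext j
  have hb := isNormalBasis_param w σ c j.1
  rw [h] at hb
  rw [← rows_newPivot_missedPivot w σ c j, ← rows_newPivot_missedPivot w σ c' j,
    (isNormalBasis_param w σ c' j.1).row_congr hb (newPivot_mem w σ j.1)]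

/-- The parametrisation is a homeomorphism onto the cell for the Zariski topologies, because its
inverse is given by entries of normalised bases. -/
lemma isEmbedding_param :
    @IsEmbedding _ _ (zariskiAffine {j // IsFree w σ j}) (zariskiGrProd (colDim w) n)
      (param w σ) := by
  let _ := zariskiAffine {j // IsFree w σ j}
  refine @IsEmbedding.mk _ _ _ (zariskiGrProd (colDim w) n) _
    (@IsInducing.mk _ _ _ (zariskiGrProd (colDim w) n) _ ?_) (param_injective w σ)
  apply TopologicalSpace.ext_isClosed
  intro A
  rw [@isClosed_induced_iff _ _ (zariskiGrProd (colDim w) n)]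
  constructor
  · intro hA
    obtain ⟨I, rfl⟩ := (isClosed_zariskiAffine_iff _).1 hA
    let pos : {j // IsFree w σ j} → (j : Fin l) × (Fin (colDim w j) × Fin n) := fun j =>
      ⟨j.1, ⟨⟨w j.1, Nat.lt_succ_self _⟩, missedPivot w σ j.1⟩⟩
    refine ⟨_, @isClosed_biInter _ _ (zariskiGrProd (colDim w) n) I _ fun f _ =>
      isClosed_setOf_normalBasis_eval_eq_zero (colDim_le w)
        (fun j => initialProd w σ j.succ) pos f, ?_⟩
    ext c
    simp only [Set.mem_preimage, Set.mem_iInter, Set.mem_ofPred_eq]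
    refine forall₂_congr fun f _ => ?_
    have hc : ∀ b : Fin l → Fin n → Fin n → ℂ,
        (∀ j, IsNormalBasis (pivots (initialProd w σ j.succ) (colDim w j)) (param w σ c j).1
          (b j)) → ∀ j : {j // IsFree w σ j},
        b j.1 (newPivot w σ j.1) (missedPivot w σ j.1) = c j := by
      intro b hb j
      rw [← rows_newPivot_missedPivot w σ c j,
        (isNormalBasis_param w σ c j.1).row_congr (hb j.1) (newPivot_mem w σ j.1)]
    constructor
    · intro h
      have := h _ (isNormalBasis_param w σ c)
      rw [← this]
      congr 2
      funext j
      exact (hc _ (isNormalBasis_param w σ c) j).symm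
    · intro h b hb
      rw [← h]
      congr 2
      funext j
      exact hc b hb j
  · rintro ⟨W, hW, rfl⟩
    exact @IsClosed.preimage _ _ _ (zariskiGrProd (colDim w) n) _ (continuous_param w σ) _ hW

lemma topologicalKrullDim_range {X Y : Type*} [TopologicalSpace X] [TopologicalSpace Y]
    {f : X → Y} (hf : IsEmbedding f) :
    topologicalKrullDim (Set.range f) = topologicalKrullDim X :=
  (IsHomeomorph.topologicalKrullDim_eq _ hf.toHomeomorph.isHomeomorph).symm

theorem zariskiDim_cell : zariskiDim (cell w σ) = ((numPlus w σ : ℕ) : WithBot ℕ∞) := by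
  rw [← range_param, numPlus_eq_natCard, ← topologicalKrullDim_zariskiAffine]
  exact @topologicalKrullDim_range _ _ (zariskiAffine _) (zariskiGrProd (colDim w) n) _
    (isEmbedding_param w σ)

end Dimension

end BottSamelson

end

theorem mainTheorem8 (n l : ℕ) (w : Fin l → Fin (n - 1))
    (hw : BottSamelson.IsReduced (List.ofFn w)) (σ : BottSamelson.Mask l) :
    BottSamelson.numPlus w σ = BottSamelson.length (BottSamelson.maskProd w σ) + BottSamelson.numDefects w σ ∧
    BottSamelson.zariskiDim (BottSamelson.cell w σ) = ((BottSamelson.numPlus w σ : ℕ) : WithBot ℕ∞) ∧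
    ∃ D : ℕ, BottSamelson.zariskiDim (BottSamelson.cell w σ) = (D : WithBot ℕ∞) ∧
      (BottSamelson.numDefects w σ : ℤ) = (D : ℤ) - (BottSamelson.length (BottSamelson.maskProd w σ) : ℤ) := by
  have hplus := BottSamelson.numPlus_eq_length_add_numDefects w σ
  have hdim := BottSamelson.zariskiDim_cell w σ
  refine ⟨hplus, hdim, _, hdim, ?_⟩
  omega
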